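/- **Definitions.** All algebras and vector spaces are over $\mathbb C$. A *non-commutative probability space* $(\mathcal A,\varphi)$ is a unital algebra $\mathcal A$ with a linear functional $\varphi:\mathcal A\to\mathbb C$, $\varphi(1)=1$. Let $I,J$ be disjoint sets. A *two-faced family* in $(\mathcal A,\varphi)$ is a family $z=((z_i)_{i\in I},(z_j)_{j\in J})$ of elements of $\mathcal A$ (left variables indexed by $I$, right variables by $J$). A *vector space with specified state-vector* is a triple $(\mathcal X,\mathcal X^\circ,\xi)$ with $\mathcal X=\mathbb C\xi\oplus\mathcal X^\circ$ and $\xi\neq 0$; let $\psi:\mathcal X\to\mathbb C$ be the functional with $\psi(\xi)=1$, $\ker\psi=\mathcal X^\circ$. On the algebra $\mathcal L(\mathcal X)$ of linear operators put $\varphi_{\mathcal X}(T)=\psi(T\xi)$. The *free product* of a family $(\mathcal X_k,\mathcal X_k^\circ,\xi_k)_{k}$ is $$\mathcal X=\mathbb C\xi\oplus\mathcal X^\circ,\qquad \mathcal X^\circ=\bigoplus_{m\ge1}\ \bigoplus_{k_1\ne k_2\ne\dots\ne k_m}\mathcal X^\circ_{k_1}\otimes\dots\otimes\mathcal X^\circ_{k_m}.$$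 Let $\mathcal X(l,k)$, resp. $\mathcal X(r,k)$, be the sum of $\mathbb C\xi$ and of the summands with $k_1\ne k$, resp. $k_m\ne k$. There are natural identifications $V_k:\mathcal X_k\otimes\mathcal X(l,k)\to\mathcal X$ and $W_k:\mathcal X(r,k)\otimes\mathcal X_k\to\mathcal X$ ($\xi_k$ and $\xi$ act as empty tensors, and otherwise tensors are concatenated). For $T\in\mathcal L(\mathcal X_k)$ put $\lambda_k(T)=V_k(T\otimes 1)V_k^{-1}$ and $\rho_k(T)=W_k(1\otimes T)W_k^{-1}$. A pair $(z',z'')=(z_1,z_2)$ of two-faced families in $(\mathcal A,\varphi)$ is *bi-free* if there are vector spaces with specified state-vector $\mathcal X_1,\mathcal X_2$, with free product $\mathcal X$, and unital homomorphisms $l_k:\mathbb C\langle X_i\mid i\in I\rangle\to\mathcal L(\mathcal X_k)$, $r_k:\mathbb C\langle Y_j\mid j\in J\rangle\to\mathcal L(\mathcal X_k)$ $(k=1,2)$ such that the families $(z_{k,i},z_{k,j})_{k,i,j}$ in $(\mathcal A,\varphi)$ and $(\lambda_k(l_k(X_i)),\rho_k(r_k(Y_j)))_{k,i,j}$ in $(\mathcal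 L(\mathcal X),\varphi_{\mathcal X})$ have the same joint distribution, i.e. every non-commutative polynomial in the variables has the same expectation on both. **Theorem 5.7 (existence and uniqueness of bi-free cumulants).** Let $n\ge1$ and $\alpha:\{1,\dots,n\}\to I\sqcup J$. For $\emptyset\ne K=\{k_1<\dots<k_r\}\subset\{1,\dots,n\}$ let $\alpha K:\{1,\dots,r\}\to I\sqcup J$ be the map $a\mapsto\alpha(k_a)$, and let $X_{\alpha K}$ be commuting indeterminates, indexed by the maps $\alpha K$ (so $X_{\alpha K}=X_{\alpha L}$ when $\alpha K=\alpha L$). For a two-faced family $z$ in $(\mathcal A,\varphi)$ write $M_{\alpha K}(z)=\varphi(z_{\alpha(k_1)}\cdots z_{\alpha(k_r)})$. Then there is exactly one polynomial $R_\alpha$ with complex coefficients in the indeterminates $X_{\alpha K}$, $\emptyset\ne K\subset\{1,\dots,n\}$, such that 1. $R_\alpha=X_{\alpha\{1,\dots,n\}}+\tilde R_\alpha$, where $\tilde R_\alpha$ is a polynomial in the $X_{\alpha K}$ with $\emptyset\ne K\subsetneq\{1,\dots,n\}$; 2. $R_\alpha$ is homogeneous of degree $n$ when $X_{\alpha K}$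 is given degree $|K|$; 3. (cumulant property) for every non-commutative probability space $(\mathcal A,\varphi)$ and every bi-free pair $z',z''$ of two-faced families in $(\mathcal A,\varphi)$, with $z'+z''=((z'_i+z''_i)_{i\in I},(z'_j+z''_j)_{j\in J})$, $$R_\alpha\big(M_{\alpha K}(z')\mid\emptyset\ne K\subset\{1,\dots,n\}\big)+R_\alpha\big(M_{\alpha K}(z'')\mid\emptyset\ne K\subset\{1,\dots,n\}\big)=R_\alpha\big(M_{\alpha K}(z'+z'')\mid\emptyset\ne K\subset\{1,\dots,n\}\big).$$ -/

import Mathlib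

open scoped TensorProduct DirectSum

universe u v w x

namespace BiFree

/-! ### Vector spaces with specified state-vector and their free product -/

/-- A complex vector space with specified state-vector `(𝒳, 𝒳°, ξ)`, described by `(𝒳, ψ, ξ)` where
`ψ` is the linear functional with `ψ ξ = 1` and `ker ψ = 𝒳°`. -/
structure StateSpace : Type (u + 1) where
  carrier : Type u
  [addCommGroup : AddCommGroup carrier]
  [module : Module ℂ carrier]
  ξ : carrier
  ψ : carrier →ₗ[ℂ] ℂ
  ψ_ξ : ψ ξ = 1

attribute [instance] StateSpace.addCommGroup StateSpace.module

namespace StateSpace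

/-- The subspace `𝒳°` of codimension one. -/
abbrev circ (X : StateSpace.{u}) : Submodule ℂ X.carrier := LinearMap.ker X.ψ

/-- The expectation functional `φ_p` on `ℒ(𝒳)`: `p T p = φ_p(T) p`, where `p x = ψ(x) ξ`. -/
def expect (X : StateSpace.{u}) : Module.End ℂ X.carrier →ₗ[ℂ] ℂ :=
  X.ψ ∘ₗ LinearMap.applyₗ X.ξ

/-- The decomposition `𝒳 = ℂ ξ ⊕ 𝒳°`. -/
def split (X : StateSpace.{u}) : X.carrier ≃ₗ[ℂ] ℂ × X.circ where
  toFun y := (X.ψ y, ⟨y - X.ψ y • X.ξ, by simp [X.ψ_ξ]⟩)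
  map_add' y z := by
    ext
    · simp
    · simp only [map_add, add_smul, Prod.mk_add_mk, AddMemClass.mk_add_mk]
      abel
  map_smul' c y := by
    ext <;> simp [smul_sub, mul_smul]
  invFun q := q.1 • X.ξ + q.2
  left_inv y := by simp
  right_inv q := by
    have h : X.ψ (q.2 : X.carrier) = 0 := q.2.2
    ext <;> simp [X.ψ_ξ, h]

end StateSpace

section FreeProduct

variable {K : Type v} (X : K → StateSpace.{u})

/-- The tensor product `𝒳°_{k₁} ⊗ ⋯ ⊗ 𝒳°_{kₙ}` attached to a word `k₁ ⋯ kₙ`; it is `ℂ` for the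
empty word. -/
noncomputable def tensorWord : List K → ModuleCat.{u} ℂ
  | [] => ModuleCat.of ℂ (ULift.{u} ℂ)
  | k :: s => ModuleCat.of ℂ ((X k).circ ⊗[ℂ] tensorWord s)

/-- The tensor product attached to the empty word is `ℂ`. -/
noncomputable def nilEquiv : tensorWord X [] ≃ₗ[ℂ] ℂ :=
  (ULift.moduleEquiv : ULift.{u} ℂ ≃ₗ[ℂ] ℂ)

/-- `𝒳°_k ⊗ (𝒳°_{k₁} ⊗ ⋯ ⊗ 𝒳°_{kₙ})` is the tensor product attached to `k k₁ ⋯ kₙ`. -/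
noncomputable def consEquiv (k : K) (s : List K) :
    ((X k).circ ⊗[ℂ] tensorWord X s) ≃ₗ[ℂ] tensorWord X (k :: s) :=
  LinearEquiv.refl ℂ ((X k).circ ⊗[ℂ] tensorWord X s)

/-- The words `k₁ ⋯ kₙ` with `k₁ ≠ k₂ ≠ ⋯ ≠ kₙ` (the empty word included). -/
abbrev AltWord (K : Type v) : Type v := {s : List K // s.IsChain (· ≠ ·)}

/-- The alternating words that do not begin with `i`. -/
abbrev AltWordL (i : K) : Type v := {s : AltWord K // s.1.head? ≠ some i}

/-- The alternating words that do not end with `i`. -/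
abbrev AltWordR (i : K) : Type v := {s : AltWord K // s.1.getLast? ≠ some i}

/-- The underlying vector space
`ℂ ξ ⊕ ⨁_{n ≥ 1} ⨁_{k₁ ≠ ⋯ ≠ kₙ} 𝒳°_{k₁} ⊗ ⋯ ⊗ 𝒳°_{kₙ}` of the free product. -/
abbrev FreeSpace : Type (max u v) := ⨁ s : AltWord K, tensorWord X s.1

/-- The subspace `𝒳(l, i)`, the sum over the words that do not begin with `i`. -/
abbrev FreeSpaceL (i : K) : Type (max u v) := ⨁ s : AltWordL i, tensorWord X s.1.1

/-- The subspace `𝒳(r, i)`, the sum over the words that do not end with `i`. -/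
abbrev FreeSpaceR (i : K) : Type (max u v) := ⨁ s : AltWordR i, tensorWord X s.1.1

/-- The identification
`(𝒳°_{k₁} ⊗ ⋯ ⊗ 𝒳°_{kₙ}) ⊗ 𝒳°_i ≃ 𝒳°_{k₁} ⊗ ⋯ ⊗ 𝒳°_{kₙ} ⊗ 𝒳°_i`. -/
noncomputable def snocEquiv (i : K) :
    (s : List K) → (tensorWord X s ⊗[ℂ] (X i).circ) ≃ₗ[ℂ] tensorWord X (s ++ [i])
  | [] => (TensorProduct.comm ℂ (tensorWord X []) (X i).circ).trans (consEquiv X i [])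
  | k :: s =>
      (TensorProduct.congr (consEquiv X k s).symm (LinearEquiv.refl ℂ (X i).circ)).trans <|
      (TensorProduct.assoc ℂ (X k).circ (tensorWord X s) (X i).circ).trans <|
      (TensorProduct.congr (LinearEquiv.refl ℂ (X k).circ) (snocEquiv i s)).trans <|
      consEquiv X k (s ++ [i])

/-- Prefixing the letter `i` to a word that does not begin with `i`. -/
abbrev consWord (i : K) (s : AltWordL i) : AltWord K :=
  ⟨i :: s.1.1, by
    rw [List.isChain_cons]
    exact ⟨fun y hy h => s.2 (h.symm ▸ hy : i ∈ s.1.1.head?), s.1.2⟩⟩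

/-- Appending the letter `i` to a word that does not end with `i`. -/
abbrev snocWord (i : K) (s : AltWordR i) : AltWord K :=
  ⟨s.1.1 ++ [i], by
    rw [List.isChain_append]
    refine ⟨s.1.2, by simp, fun y hy z hz h => s.2 ?_⟩
    have hz' : i = z := by simpa using hz
    exact (h.trans hz'.symm ▸ hy : i ∈ s.1.1.getLast?)⟩

/-- An alternating word either does not begin with `i`, or is `i` followed by such a word. -/
theorem bijective_consWord (i : K) :
    Function.Bijective (Sum.elim (Subtype.val : AltWordL i → AltWord K) (consWord i)) := by
  constructor
  · rintro (a | a) (b | b) h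
    · exact congrArg Sum.inl (Subtype.ext h)
    · have h' : a.1.1 = i :: b.1.1 := congrArg Subtype.val h
      exact absurd (by rw [h']; rfl) a.2
    · have h' : i :: a.1.1 = b.1.1 := congrArg Subtype.val h
      exact absurd (by rw [← h']; rfl) b.2
    · have h' : i :: a.1.1 = i :: b.1.1 := congrArg Subtype.val h
      exact congrArg Sum.inr (Subtype.ext (Subtype.ext (List.cons.inj h').2))
  · intro s
    by_cases h : s.1.head? = some i
    · obtain ⟨l, hl⟩ := s
      cases l with
      | nil => simp at h
      | cons k t =>
        obtain rfl : k = i := by simpa using h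
        have hl' := hl
        rw [List.isChain_cons] at hl'
        exact ⟨Sum.inr ⟨⟨t, hl'.2⟩, fun h' => hl'.1 k h' rfl⟩, rfl⟩
    · exact ⟨Sum.inl ⟨s, h⟩, rfl⟩

/-- An alternating word either does not end with `i`, or is such a word followed by `i`. -/
theorem bijective_snocWord (i : K) :
    Function.Bijective (Sum.elim (Subtype.val : AltWordR i → AltWord K) (snocWord i)) := by
  constructor
  · rintro (a | a) (b | b) h
    · exact congrArg Sum.inl (Subtype.ext h)
    · have h' : a.1.1 = b.1.1 ++ [i] := congrArg Subtype.val h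
      exact absurd (by rw [h']; simp) a.2
    · have h' : a.1.1 ++ [i] = b.1.1 := congrArg Subtype.val h
      exact absurd (by rw [← h']; simp) b.2
    · have h' : a.1.1 ++ [i] = b.1.1 ++ [i] := congrArg Subtype.val h
      exact congrArg Sum.inr (Subtype.ext (Subtype.ext (List.append_cancel_right h')))
  · intro s
    by_cases h : s.1.getLast? = some i
    · obtain ⟨l, hl⟩ := s
      obtain rfl | ⟨t, k, rfl⟩ := List.eq_nil_or_concat l
      · simp at h
      · obtain rfl : k = i := by simpa using h
        have hl' := hl
        rw [List.concat_eq_append, List.isChain_append] at hl'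
        exact ⟨Sum.inr ⟨⟨t, hl'.1⟩, fun h' => hl'.2.2 k h' k (by simp) rfl⟩,
          Subtype.ext List.concat_eq_append.symm⟩
    · exact ⟨Sum.inl ⟨s, h⟩, rfl⟩

open Classical in
/-- The map `⨁_a P_a → ⨁_c M_c` which sends the summand `P_a` onto `M_{f(a)}`. -/
noncomputable def inject {α γ : Type v} (f : α → γ) (M : γ → Type u) (P : α → Type u)
    [∀ c, AddCommGroup (M c)] [∀ c, Module ℂ (M c)]
    [∀ a, AddCommGroup (P a)] [∀ a, Module ℂ (P a)] (η : ∀ a, P a ≃ₗ[ℂ] M (f a)) :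
    (⨁ a, P a) →ₗ[ℂ] ⨁ c, M c :=
  DirectSum.toModule ℂ α (⨁ c, M c) fun a => DirectSum.lof ℂ γ M (f a) ∘ₗ (η a).toLinearMap

theorem inject_lof {α γ : Type v} [dα : DecidableEq α] [dγ : DecidableEq γ] (f : α → γ) (M : γ → Type u) (P : α → Type u)
    [∀ c, AddCommGroup (M c)] [∀ c, Module ℂ (M c)]
    [∀ a, AddCommGroup (P a)] [∀ a, Module ℂ (P a)] (η : ∀ a, P a ≃ₗ[ℂ] M (f a)) (a : α)
    (m : P a) :
    inject f M P η (DirectSum.lof ℂ α P a m) = DirectSum.lof ℂ γ M (f a) (η a m) := by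
  obtain rfl := Subsingleton.elim dα (fun a b => Classical.propDecidable (a = b))
  obtain rfl := Subsingleton.elim dγ (fun a b => Classical.propDecidable (a = b))
  rw [inject, DirectSum.toModule_lof]
  rfl

theorem inject_apply {α γ : Type v} (f : α → γ) (hf : Function.Injective f) (M : γ → Type u)
    (P : α → Type u) [∀ c, AddCommGroup (M c)] [∀ c, Module ℂ (M c)]
    [∀ a, AddCommGroup (P a)] [∀ a, Module ℂ (P a)] (η : ∀ a, P a ≃ₗ[ℂ] M (f a))
    (y : ⨁ a, P a) (a : α) : inject f M P η y (f a) = η a (y a) := by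
  classical
  induction y using DirectSum.induction_on with
  | zero => simp
  | of b m =>
    rw [← DirectSum.lof_eq_of ℂ α P, inject_lof, DirectSum.lof_eq_of, DirectSum.lof_eq_of]
    by_cases h : b = a
    · subst h
      rw [DirectSum.of_eq_same, DirectSum.of_eq_same]
    · rw [DirectSum.of_eq_of_ne _ _ _ (fun h' => h (hf h').symm),
        DirectSum.of_eq_of_ne _ _ _ (Ne.symm h), map_zero]
  | add y y' hy hy' => rw [map_add, DirectSum.add_apply, hy, hy', DirectSum.add_apply, map_add]

theorem inject_apply_of_ne {α γ : Type v} (f : α → γ) (M : γ → Type u)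
    (P : α → Type u) [∀ c, AddCommGroup (M c)] [∀ c, Module ℂ (M c)]
    [∀ a, AddCommGroup (P a)] [∀ a, Module ℂ (P a)] (η : ∀ a, P a ≃ₗ[ℂ] M (f a))
    (y : ⨁ a, P a) (c : γ) (hc : ∀ a, f a ≠ c) : inject f M P η y c = 0 := by
  classical
  induction y using DirectSum.induction_on with
  | zero => simp
  | of b m =>
    rw [← DirectSum.lof_eq_of ℂ α P, inject_lof, DirectSum.lof_eq_of,
      DirectSum.of_eq_of_ne _ _ _ (hc b).symm]
  | add y y' hy hy' => rw [map_add, DirectSum.add_apply, hy, hy', add_zero]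

/-- If `α ⊕ β → γ` is a bijection, then `⨁_a P_a ⊕ ⨁_b Q_b ≃ ⨁_c M_c`, with `P_a` sent onto
`M_{f(a)}` and `Q_b` onto `M_{g(b)}`. -/
noncomputable def gather {α β γ : Type v} (f : α → γ) (g : β → γ)
    (hfg : Function.Bijective (Sum.elim f g)) (M : γ → Type u) (P : α → Type u) (Q : β → Type u)
    [∀ c, AddCommGroup (M c)] [∀ c, Module ℂ (M c)] [∀ a, AddCommGroup (P a)]
    [∀ a, Module ℂ (P a)] [∀ b, AddCommGroup (Q b)] [∀ b, Module ℂ (Q b)]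
    (η : ∀ a, P a ≃ₗ[ℂ] M (f a)) (θ : ∀ b, Q b ≃ₗ[ℂ] M (g b)) :
    ((⨁ a, P a) × (⨁ b, Q b)) ≃ₗ[ℂ] ⨁ c, M c :=
  LinearEquiv.ofBijective (LinearMap.coprod (inject f M P η) (inject g M Q θ)) <| by
    classical
    have hf : Function.Injective f := hfg.1.comp Sum.inl_injective
    have hg : Function.Injective g := hfg.1.comp Sum.inr_injective
    have hne : ∀ a b, f a ≠ g b := fun a b h => by
      have h' : (Sum.inl a : α ⊕ β) = Sum.inr b := hfg.1 h
      cases h'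
    constructor
    · rw [← LinearMap.ker_eq_bot, LinearMap.ker_eq_bot']
      rintro ⟨y, z⟩ h
      have hs : ∀ c, inject f M P η y c + inject g M Q θ z c = 0 := fun c => by
        rw [LinearMap.coprod_apply] at h
        rw [← DirectSum.add_apply, h, DirectSum.zero_apply]
      refine Prod.ext (DFinsupp.ext fun a => ?_) (DFinsupp.ext fun b => ?_)
      · have := hs (f a)
        rw [inject_apply f hf, inject_apply_of_ne g _ _ _ _ _ fun b => (hne a b).symm,
          add_zero] at this
        exact (η a).map_eq_zero_iff.1 this
      · have := hs (g b)
        rw [inject_apply g hg, inject_apply_of_ne f _ _ _ _ _ fun a => hne a b,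
          zero_add] at this
        exact (θ b).map_eq_zero_iff.1 this
    · rw [← LinearMap.range_eq_top, eq_top_iff]
      intro z _
      induction z using DirectSum.induction_on with
      | zero => exact zero_mem _
      | of c m =>
        obtain ⟨a | b, rfl⟩ := hfg.2 c
        · obtain ⟨p, rfl⟩ := (η a).surjective m
          refine ⟨(DirectSum.lof ℂ α P a p, 0), ?_⟩
          rw [LinearMap.coprod_apply, map_zero, add_zero, inject_lof]
          rfl
        · obtain ⟨q, rfl⟩ := (θ b).surjective m
          refine ⟨(0, DirectSum.lof ℂ β Q b q), ?_⟩
          rw [LinearMap.coprod_apply, map_zero, zero_add, inject_lof]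
          rfl
      | add z z' hz hz' => exact add_mem (hz trivial) (hz' trivial)

open Classical in
/-- The natural identification `V_i : 𝒳_i ⊗ 𝒳(l, i) ≃ 𝒳`, given by `ξ_i ⊗ y ↦ y` and
`x ⊗ y ↦ x ⊗ y` for `x ∈ 𝒳°_i`. -/
noncomputable def V (i : K) : ((X i).carrier ⊗[ℂ] FreeSpaceL X i) ≃ₗ[ℂ] FreeSpace X :=
  (TensorProduct.congr (X i).split (LinearEquiv.refl ℂ (FreeSpaceL X i))).trans <|
  (TensorProduct.prodLeft ℂ ℂ ℂ (X i).circ (FreeSpaceL X i)).trans <|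
  (LinearEquiv.prodCongr (TensorProduct.lid ℂ (FreeSpaceL X i))
    (TensorProduct.directSumRight ℂ ℂ (X i).circ
      (fun s : AltWordL i => tensorWord X s.1.1))).trans <|
  gather Subtype.val (consWord i) (bijective_consWord i) (fun s : AltWord K => tensorWord X s.1)
    (fun s : AltWordL i => tensorWord X s.1.1)
    (fun s : AltWordL i => (X i).circ ⊗[ℂ] tensorWord X s.1.1)
    (fun s => LinearEquiv.refl ℂ (tensorWord X s.1.1)) (fun s => consEquiv X i s.1.1)

open Classical in
/-- The natural identification `W_i : 𝒳(r, i) ⊗ 𝒳_i ≃ 𝒳`, given by `y ⊗ ξ_i ↦ y` and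
`y ⊗ x ↦ y ⊗ x` for `x ∈ 𝒳°_i`. -/
noncomputable def W (i : K) : (FreeSpaceR X i ⊗[ℂ] (X i).carrier) ≃ₗ[ℂ] FreeSpace X :=
  (TensorProduct.congr (LinearEquiv.refl ℂ (FreeSpaceR X i)) (X i).split).trans <|
  (TensorProduct.prodRight ℂ ℂ (FreeSpaceR X i) ℂ (X i).circ).trans <|
  (LinearEquiv.prodCongr (TensorProduct.rid ℂ (FreeSpaceR X i))
    (TensorProduct.directSumLeft ℂ ℂ (fun s : AltWordR i => tensorWord X s.1.1)
      (X i).circ)).trans <|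
  gather Subtype.val (snocWord i) (bijective_snocWord i) (fun s : AltWord K => tensorWord X s.1)
    (fun s : AltWordR i => tensorWord X s.1.1)
    (fun s : AltWordR i => tensorWord X s.1.1 ⊗[ℂ] (X i).circ)
    (fun s => LinearEquiv.refl ℂ (tensorWord X s.1.1)) (fun s => snocEquiv X i s.1.1)

open Classical in
/-- The free product of a family of vector spaces with specified state-vector. -/
noncomputable abbrev freeProduct : StateSpace.{max u v} where
  carrier := FreeSpace X
  ξ := DirectSum.lof ℂ (AltWord K) (fun s => tensorWord X s.1) ⟨[], List.isChain_nil⟩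
    ((nilEquiv X).symm 1)
  ψ := (nilEquiv X).toLinearMap ∘ₗ
    DirectSum.component ℂ (AltWord K) (fun s => tensorWord X s.1) ⟨[], List.isChain_nil⟩
  ψ_ξ := by
    rw [LinearMap.comp_apply, DirectSum.component.lof_self]
    exact (nilEquiv X).apply_symm_apply 1

/-- The left representation `λ_i(T) = V_i (T ⊗ 1) V_i⁻¹`. -/
noncomputable def leftRep (i : K) :
    Module.End ℂ (X i).carrier →ₐ[ℂ] Module.End ℂ (freeProduct X).carrier :=
  ((V X i).conjAlgEquiv ℂ).toAlgHom.comp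
    (Module.End.rTensorAlgHom ℂ (X i).carrier (FreeSpaceL X i))

/-- The right representation `ρ_i(T) = W_i (1 ⊗ T) W_i⁻¹`. -/
noncomputable def rightRep (i : K) :
    Module.End ℂ (X i).carrier →ₐ[ℂ] Module.End ℂ (freeProduct X).carrier :=
  ((W X i).conjAlgEquiv ℂ).toAlgHom.comp
    (Module.End.lTensorAlgHom ℂ (X i).carrier (FreeSpaceR X i))

end FreeProduct

/-! ### Two-faced families and bi-freeness

A two-faced family in `A` is a map `z : I ⊕ J → A`; `z (Sum.inl i)` are the left variables and
`z (Sum.inr j)` the right ones. A non-commutative probability space is a unital complex algebra `A`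
with a linear functional `φ` such that `φ 1 = 1`. -/

section BiFreeness

variable {I : Type u} {J : Type v} {K : Type x}

/-- The joint distribution `ℂ⟨Z_{k,a}⟩ → ℂ`, `P ↦ φ (P(z))`, of a family of two-faced families. -/
noncomputable def jointDistribution {A : Type w} [Ring A] [Algebra ℂ A] (φ : A →ₗ[ℂ] ℂ)
    (z : K → I ⊕ J → A) : FreeAlgebra ℂ (K × (I ⊕ J)) →ₗ[ℂ] ℂ :=
  φ ∘ₗ (FreeAlgebra.lift ℂ fun q : K × (I ⊕ J) => z q.1 q.2).toLinearMap

/-- For unital homomorphisms `l_k : ℂ⟨X_i⟩ → ℒ(𝒳_k)` and `r_k : ℂ⟨Y_j⟩ → ℒ(𝒳_k)`, the two-faced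
families `((λ_k (l_k X_i))_i, (ρ_k (r_k Y_j))_j)` of operators on the free product `*_k 𝒳_k`. -/
noncomputable def modelFamily (X : K → StateSpace.{max u v})
    (l : ∀ k, FreeAlgebra ℂ I →ₐ[ℂ] Module.End ℂ (X k).carrier)
    (r : ∀ k, FreeAlgebra ℂ J →ₐ[ℂ] Module.End ℂ (X k).carrier) (k : K) :
    I ⊕ J → Module.End ℂ (freeProduct X).carrier :=
  Sum.elim (fun i => leftRep X k (l k (FreeAlgebra.ι ℂ i)))
    (fun j => rightRep X k (r k (FreeAlgebra.ι ℂ j)))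

/-- A family `(z_k)_{k ∈ K}` of two-faced families in `(A, φ)` is bi-free if, for some vector spaces
with specified state-vector `𝒳_k` and some unital homomorphisms `l_k`, `r_k` of the two faces
`ℂ⟨X_i⟩`, `ℂ⟨Y_j⟩` into `ℒ(𝒳_k)`, it has the same joint distribution as the faces
`λ_k ∘ l_k`, `ρ_k ∘ r_k` acting on the free product of the `𝒳_k`.
The universe of the `𝒳_k` contains `ℂ⟨X_i, Y_j⟩`, so a larger one gives the same notion. -/
def IsBiFree {A : Type w} [Ring A] [Algebra ℂ A] (φ : A →ₗ[ℂ] ℂ) (z : K → I ⊕ J → A) : Prop :=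
  ∃ (X : K → StateSpace.{max u v})
    (l : ∀ k, FreeAlgebra ℂ I →ₐ[ℂ] Module.End ℂ (X k).carrier)
    (r : ∀ k, FreeAlgebra ℂ J →ₐ[ℂ] Module.End ℂ (X k).carrier),
    jointDistribution φ z = jointDistribution (freeProduct X).expect (modelFamily X l r)

end BiFreeness

/-! ### Moments and the variables `X_{αK}` -/

section Moments

variable {Γ : Type x} {n : ℕ}

/-- The map `α K = α ∘ b_K`, with `b_K : {1, …, |K|} → K` the increasing bijection, written as the
list of its values `α(k₁), …, α(k_r)` for `K = {k₁ < ⋯ < k_r}`. -/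
def subword (α : Fin n → Γ) (K : Finset (Fin n)) : List Γ := (K.sort (· ≤ ·)).map α

/-- The index set `{α K | ∅ ≠ K ⊆ {1, …, n}}` of the variables `X_{αK}`. Subsets `K`, `L` with
`α K = α L` name the same variable. -/
abbrev MomentIndex (α : Fin n → Γ) : Type x :=
  {s : List Γ // ∃ K : Finset (Fin n), K.Nonempty ∧ subword α K = s}

/-- `α K` as an index of a variable, for `K ≠ ∅`. -/
def momentIndex (α : Fin n → Γ) (K : Finset (Fin n)) (hK : K.Nonempty) : MomentIndex α :=
  ⟨subword α K, K, hK, rfl⟩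

/-- The moments `M_{αK} = φ(z_{α(k₁)} ⋯ z_{α(k_r)})`, `K = {k₁ < ⋯ < k_r}`, of a family `z`. -/
def moments {A : Type w} [Ring A] [Algebra ℂ A] (φ : A →ₗ[ℂ] ℂ) (z : Γ → A) (α : Fin n → Γ) :
    MomentIndex α → ℂ :=
  fun s => φ (s.1.map z).prod

end Moments

end BiFree

/-! Bi-free variables are modelled on a Fock space spanned by sequences of coloured blocks. A left
letter of colour `k` opens a block at the left end, or joins the first block if that has colour `k`;
the block then stays open or is closed at the price of its cumulant `κ k`. Right letters act in the
same way at the right end. The vacuum expectation of a product of letters is a polynomial in the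
cumulants. Three facts give existence.

Triangularity: with indeterminate cumulants, the moment of a nonempty word `s` is `X s` plus a
weighted homogeneous polynomial in the cumulants of its shorter nonempty subwords
(`vec_sub_mem_lowerTerms`, `momentRest_spec`). Solving recursively for the cumulants gives
`cumulantPoly`.

Additivity: summing the operators over the colours amounts to using one colour with the sum of the
cumulants, each block being replaced by the sum of its colourings (`specialize_op`, `vac_sum_op`).

Universality: a bi-free family has the joint distribution of the model whose `κ k` are the cumulants
of the separate families (`jointDistribution_modelFamily`). No map between the two spaces is needed.
A linear correspondence pairs elementary tensors in the free product with products in the Fock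
algebra; all operators preserve it, and on it the two vacuum functionals agree.

For uniqueness, the difference `D` of two solutions is additive, homogeneous of degree `n`, and
involves only moments of proper subwords. Rewrite it as a polynomial `P` in the cumulants. Any
cumulants `κ` can be given to both members of a bi-free pair (`exists_isBiFree`), so `P(2κ) = 2P(κ)`
and `P` is linear; but its variables have weight less than `n`, so `P = 0` (`eq_zero_of_doubling`).
Since moments can be prescribed through their cumulants, `D = 0`. -/

namespace BiFree

/-! ### The Fock space of coloured blocks and its operators. -/

section Fock

/-- The space spanned by the finite sequences of coloured blocks, a block being a word in `Γ`; the
product is concatenation. -/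
abbrev Fock (C : Type*) [CommRing C] (K Γ : Type*) := MonoidAlgebra C (FreeMonoid (K × List Γ))

namespace Fock

variable {C : Type*} [CommRing C] {K Γ I J : Type*}

/-- The basis vector given by a sequence of blocks. -/
noncomputable def mono (C : Type*) [CommRing C] (L : List (K × List Γ)) : Fock C K Γ :=
  MonoidAlgebra.of C _ (FreeMonoid.ofList L)

/-- The basis vector given by a single block. -/
noncomputable def blk (C : Type*) [CommRing C] (b : K × List Γ) : Fock C K Γ := mono C [b]

theorem mono_nil : mono C ([] : List (K × List Γ)) = 1 := map_one _

theorem mono_singleton (b : K × List Γ) : mono C [b] = blk C b := rfl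

theorem mono_append (L L' : List (K × List Γ)) : mono C (L ++ L') = mono C L * mono C L' := by
  rw [mono, FreeMonoid.ofList_append, map_mul]; rfl

theorem mono_cons (b : K × List Γ) (L : List (K × List Γ)) :
    mono C (b :: L) = blk C b * mono C L := mono_append [b] L

@[elab_as_elim]
theorem induction_mono {P : Fock C K Γ → Prop} (a : Fock C K Γ) (hm : ∀ L, P (mono C L))
    (hadd : ∀ a b, P a → P b → P (a + b)) (hsmul : ∀ (c : C) a, P a → P (c • a)) : P a :=
  MonoidAlgebra.induction_on a (fun L => hm L) hadd hsmul

/-- The linear extension of a map defined on sequences of blocks. -/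
noncomputable def extend (f : List (K × List Γ) → Fock C K Γ) : Fock C K Γ →ₗ[C] Fock C K Γ :=
  (MonoidAlgebra.basis (FreeMonoid (K × List Γ)) C).constr C fun L => f L.toList

@[simp] theorem extend_mono (f : List (K × List Γ) → Fock C K Γ) (L : List (K × List Γ)) :
    extend f (mono C L) = f L := by
  have h : mono C L = MonoidAlgebra.basis (FreeMonoid (K × List Γ)) C
    (FreeMonoid.ofList L) := by simp [mono]
  rw [extend, h, Module.Basis.constr_basis]; rfl

/-- The coefficient of the empty sequence. -/
noncomputable def vac : Fock C K Γ →ₐ[C] C :=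
  MonoidAlgebra.lift C C (FreeMonoid (K × List Γ)) (FreeMonoid.lift fun _ => 0)

@[simp] theorem vac_blk (b : K × List Γ) : vac (blk C b) = 0 := by
  simp [vac, blk, mono]

@[simp] theorem vac_mono_cons (b : K × List Γ) (L : List (K × List Γ)) :
    vac (mono C (b :: L)) = 0 := by
  simp [mono_cons]

/-- Reversal of the order of the blocks. -/
noncomputable def rev : Fock C K Γ →ₗ[C] Fock C K Γ := extend fun L => mono C L.reverse

@[simp] theorem rev_mono (L : List (K × List Γ)) : rev (mono C L) = mono C L.reverse :=
  extend_mono _ _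

@[simp] theorem rev_blk (b : K × List Γ) : rev (blk C b) = blk C b := rev_mono _

@[simp] theorem rev_one : rev (1 : Fock C K Γ) = 1 := by
  rw [← mono_nil, rev_mono]; rfl

theorem rev_mul (a b : Fock C K Γ) : rev (a * b) = rev b * rev a := by
  induction a using induction_mono with
  | hm L =>
    induction b using induction_mono with
    | hm L' => rw [← mono_append, rev_mono, rev_mono, rev_mono, List.reverse_append, mono_append]
    | hadd b b' h h' => simp [mul_add, add_mul, h, h']
    | hsmul c b h => simp [h]
  | hadd b b' h h' => simp [mul_add, add_mul, h, h']
  | hsmul c b h => simp [h]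

@[simp] theorem rev_rev (a : Fock C K Γ) : rev (rev a) = a := by
  induction a using induction_mono with
  | hm L => simp
  | hadd b b' h h' => simp [h, h']
  | hsmul c b h => simp [h]

@[simp] theorem vac_rev (a : Fock C K Γ) : vac (rev a) = vac a := by
  induction a using induction_mono with
  | hm L =>
    induction L with
    | nil => simp [mono_nil]
    | cons b L h => rw [mono_cons, rev_mul]; simp
  | hadd b b' h h' => simp [h, h']
  | hsmul c b h => simp [h]

variable (C) in
/-- The sequences of blocks of colour `k`. -/
noncomputable def colour (Γ : Type*) (k : K) : Subalgebra C (Fock C K Γ) :=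
  Algebra.adjoin C (Set.range fun s : List Γ => blk C (k, s))

theorem blk_mem_colour (k : K) (s : List Γ) : blk C (k, s) ∈ colour C Γ k :=
  Algebra.subset_adjoin ⟨s, rfl⟩

variable [DecidableEq K] (κ : K → List Γ → C)

/-- The letter `i` of colour `k` joins the first block, which stays open or is closed. -/
noncomputable def joinL (k : K) (i : Γ) : Fock C K Γ →ₗ[C] Fock C K Γ :=
  extend fun
    | [] => 0
    | b :: L => if b.1 = k then mono C ((k, i :: b.2) :: L) + κ k (i :: b.2) • mono C L else 0

/-- The letter `i` of colour `k` joins the last block, which stays open or is closed. -/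
noncomputable def joinR (k : K) (i : Γ) : Fock C K Γ →ₗ[C] Fock C K Γ :=
  -- `rev` permutes the blocks but leaves the word inside each block alone. So right letters are
  -- also prefixed, and every block lists its letters in the order of the operator product,
  -- whichever face they come from.
  rev ∘ₗ joinL κ k i ∘ₗ rev

variable {κ}

@[simp] theorem joinL_one (k : K) (i : Γ) : joinL κ k i 1 = 0 := by
  rw [← mono_nil, joinL, extend_mono]

@[simp] theorem joinR_one (k : K) (i : Γ) : joinR κ k i 1 = 0 := by
  simp [joinR]

theorem joinL_blk (k : K) (i : Γ) (b : K × List Γ) :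
    joinL κ k i (blk C b) = if b.1 = k then blk C (k, i :: b.2) + κ k (i :: b.2) • 1 else 0 := by
  rw [blk, joinL, extend_mono]; simp [mono_nil, blk]

theorem joinR_blk (k : K) (i : Γ) (b : K × List Γ) :
    joinR κ k i (blk C b) = if b.1 = k then blk C (k, i :: b.2) + κ k (i :: b.2) • 1 else 0 := by
  simp only [joinR, LinearMap.comp_apply, rev_blk, joinL_blk]
  split_ifs <;> simp

/-- Only the first block is affected, and the first block of a product lies in `a` unless `a`
contributes the empty sequence; this gives a derivation twisted by `vac`. -/
theorem joinL_mul (k : K) (i : Γ) (a b : Fock C K Γ) :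
    joinL κ k i (a * b) = joinL κ k i a * b + vac a • joinL κ k i b := by
  induction a using induction_mono with
  | hm L =>
    cases L with
    | nil => simp [mono_nil]
    | cons c L =>
      induction b using induction_mono with
      | hm L' =>
        rw [← mono_append, vac_mono_cons, zero_smul, add_zero, List.cons_append, joinL,
          extend_mono, extend_mono]
        dsimp only
        split_ifs
        · simp only [add_mul, smul_mul_assoc, ← mono_append, List.cons_append]
        · simp
      | hadd b b' h h' => simp only [mul_add, map_add, h, h', smul_add]; abel
      | hsmul r b h => simp only [mul_smul_comm, map_smul, h, smul_add, smul_comm r]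
  | hadd a a' h h' => simp only [add_mul, map_add, h, h', add_smul]; abel
  | hsmul r a h =>
    simp only [smul_mul_assoc, map_smul, h, smul_add, smul_smul, smul_eq_mul]

theorem joinR_mul (k : K) (i : Γ) (a b : Fock C K Γ) :
    joinR κ k i (a * b) = a * joinR κ k i b + vac b • joinR κ k i a := by
  simp [joinR, rev_mul, joinL_mul]

variable (κ)

/-- A left letter opens a new first block, which may be closed at once, or joins the first block. -/
noncomputable def opL (k : K) (i : Γ) : Module.End C (Fock C K Γ) :=
  LinearMap.mulLeft C (blk C (k, [i])) + κ k [i] • 1 + joinL κ k i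

/-- A right letter opens a new last block, which may be closed at once, or joins the last block. -/
noncomputable def opR (k : K) (i : Γ) : Module.End C (Fock C K Γ) :=
  LinearMap.mulRight C (blk C (k, [i])) + κ k [i] • 1 + joinR κ k i

variable {κ}

theorem opL_apply (k : K) (i : Γ) (a : Fock C K Γ) :
    opL κ k i a = blk C (k, [i]) * a + κ k [i] • a + joinL κ k i a := rfl

theorem opR_apply (k : K) (i : Γ) (a : Fock C K Γ) :
    opR κ k i a = a * blk C (k, [i]) + κ k [i] • a + joinR κ k i a := rfl

/-- When `vac a = 0` the operator acts on the left factor alone, just as a left representation acts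
on the first tensor factor only. -/
theorem opL_mul (k : K) (i : Γ) (a b : Fock C K Γ) :
    opL κ k i (a * b) = opL κ k i a * b + vac a • joinL κ k i b := by
  simp only [opL_apply, joinL_mul, add_mul, mul_assoc, smul_mul_assoc, add_assoc]

theorem opR_mul (k : K) (i : Γ) (a b : Fock C K Γ) :
    opR κ k i (a * b) = a * opR κ k i b + vac b • joinR κ k i a := by
  simp only [opR_apply, joinR_mul, mul_add, mul_assoc, mul_smul_comm, add_assoc]

/-- The operators of the two-faced family of colour `k`. -/
noncomputable def op (κ : K → List (I ⊕ J) → C) (k : K) : I ⊕ J → Module.End C (Fock C K (I ⊕ J))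
  | Sum.inl i => opL κ k (Sum.inl i)
  | Sum.inr j => opR κ k (Sum.inr j)

theorem join_mem_colour (k : K) (i : Γ) {a : Fock C K Γ} (ha : a ∈ colour C Γ k) :
    joinL κ k i a ∈ colour C Γ k ∧ joinR κ k i a ∈ colour C Γ k := by
  induction ha using Algebra.adjoin_induction with
  | mem a h =>
    obtain ⟨s, rfl⟩ := h
    simp only [joinL_blk, joinR_blk, if_true, and_self]
    exact add_mem (blk_mem_colour _ _) (Subalgebra.smul_mem _ (one_mem _) _)
  | algebraMap r => simp [Algebra.algebraMap_eq_smul_one]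
  | add a b _ _ h h' =>
    simp only [map_add]
    exact ⟨add_mem h.1 h'.1, add_mem h.2 h'.2⟩
  | mul a b ha hb h h' =>
    rw [joinL_mul, joinR_mul]
    exact ⟨add_mem (mul_mem h.1 hb) (Subalgebra.smul_mem _ h'.1 _),
      add_mem (mul_mem ha h'.2) (Subalgebra.smul_mem _ h.2 _)⟩

/-- A letter cannot join a block of another colour. Hence on a foreign colour the operators reduce
to multiplication by their value at the vacuum. -/
theorem join_eq_zero {k c : K} (hc : c ≠ k) (i : Γ) {a : Fock C K Γ} (ha : a ∈ colour C Γ c) :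
    joinL κ k i a = 0 ∧ joinR κ k i a = 0 := by
  induction ha using Algebra.adjoin_induction with
  | mem a h =>
    obtain ⟨s, rfl⟩ := h
    simp [joinL_blk, joinR_blk, hc]
  | algebraMap r => simp [Algebra.algebraMap_eq_smul_one]
  | add a b _ _ h h' => simp [h, h']
  | mul a b ha hb h h' => simp [joinL_mul, joinR_mul, h, h']

theorem op_mem_colour (k : K) (γ : I ⊕ J) {κ : K → List (I ⊕ J) → C} {a : Fock C K (I ⊕ J)}
    (ha : a ∈ colour C (I ⊕ J) k) : op κ k γ a ∈ colour C (I ⊕ J) k := by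
  have hs : ∀ r : C, r • a ∈ colour C (I ⊕ J) k := fun r => Subalgebra.smul_mem _ ha _
  cases γ with
  | inl i =>
    exact add_mem (add_mem (mul_mem (blk_mem_colour _ _) ha) (hs _)) (join_mem_colour _ _ ha).1
  | inr j =>
    exact add_mem (add_mem (mul_mem ha (blk_mem_colour _ _)) (hs _)) (join_mem_colour _ _ ha).2

/-- The vector obtained by applying the operators of colour `k` along a word to the vacuum. -/
noncomputable def vec (κ : K → List (I ⊕ J) → C) (k : K) : List (I ⊕ J) → Fock C K (I ⊕ J)
  | [] => 1
  | γ :: s => op κ k γ (vec κ k s)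

theorem vec_mem_colour (κ : K → List (I ⊕ J) → C) (k : K) (s : List (I ⊕ J)) :
    vec κ k s ∈ colour C (I ⊕ J) k := by
  induction s with
  | nil => exact one_mem _
  | cons γ s h => exact op_mem_colour k γ h

end Fock

end Fock

/-! ### Substitution, weighted degree and supports of polynomials. -/

section Polynomials

open MvPolynomial

theorem isWeightedHomogeneous_aeval {σ τ : Type*} {a : σ → ℕ} {b : τ → ℕ}
    {f : σ → MvPolynomial τ ℂ} (hf : ∀ i, IsWeightedHomogeneous b (f i) (a i))
    {P : MvPolynomial σ ℂ} {n : ℕ} (hP : IsWeightedHomogeneous a P n) :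
    IsWeightedHomogeneous b (aeval f P) n := by
  rw [aeval_def, eval₂_eq]
  refine IsWeightedHomogeneous.sum _ _ _ fun d hd => ?_
  rw [← hP (mem_support_iff.1 hd), Finsupp.weight_apply, Finsupp.sum]
  exact (IsWeightedHomogeneous.prod _ _ _ fun i _ => (hf i).pow (d i)).C_mul _

theorem aeval_mem_supported {σ τ : Type*} {S : Set σ} {T : Set τ} {f : σ → MvPolynomial τ ℂ}
    (hf : ∀ i ∈ S, f i ∈ supported ℂ T) {P : MvPolynomial σ ℂ} (hP : P ∈ supported ℂ S) :
    aeval f P ∈ supported ℂ T := by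
  have h : supported ℂ S ≤ (supported ℂ T).comap (aeval f) := by
    rw [supported_eq_adjoin_X, Algebra.adjoin_le_iff]
    rintro _ ⟨i, hi, rfl⟩
    simpa using hf i hi
  exact h hP

theorem aeval_congr_of_mem_supported {σ A : Type*} [CommRing A] [Algebra ℂ A] {S : Set σ}
    {f g : σ → A} (h : ∀ i ∈ S, f i = g i) {P : MvPolynomial σ ℂ} (hP : P ∈ supported ℂ S) :
    aeval f P = aeval g P := by
  have h : supported ℂ S ≤ AlgHom.equalizer (aeval f) (aeval g) := by
    rw [supported_eq_adjoin_X, Algebra.adjoin_le_iff]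
    rintro _ ⟨i, hi, rfl⟩
    simpa [AlgHom.mem_equalizer] using h i hi
  exact h hP

theorem isWeightedHomogeneous_smul {σ : Type*} {a : σ → ℕ} {P : MvPolynomial σ ℂ} {n : ℕ}
    (hP : IsWeightedHomogeneous a P n) (c : ℂ) : IsWeightedHomogeneous a (c • P) n := by
  rw [smul_eq_C_mul]; exact hP.C_mul c

end Polynomials

/-! ### Moments as universal polynomials in the cumulants. -/

section Universal

open MvPolynomial Fock

variable {Γ I J : Type*}

/-- The nonempty proper subwords of a word. -/
def lower (s : List Γ) : Set (List Γ) := {t | t ≠ [] ∧ t.Sublist s ∧ t.length < s.length}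

theorem lower_subset_cons (i : Γ) (s : List Γ) : lower s ⊆ lower (i :: s) :=
  fun _ h => ⟨h.1, h.2.1.cons i, h.2.2.trans (Nat.lt_succ_self _)⟩

theorem cons_mem_lower (i : Γ) {s t : List Γ} (h : t.Sublist s) (h' : t.length < s.length) :
    i :: t ∈ lower (i :: s) :=
  ⟨by simp, h.cons_cons i, by simpa using h'⟩

/-- The universal cumulants. -/
noncomputable abbrev genCumulant (Γ : Type*) : Unit → List Γ → MvPolynomial (List Γ) ℂ :=
  fun _ s => X s

/-- The span of the terms `p • L` where `p` is a polynomial in the cumulants of the nonempty proper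
subwords of `s`, `L` is a sequence of proper subwords of `s`, and the total number of letters is
that of `s`. -/
noncomputable def lowerTerms (s : List Γ) :
    Submodule ℂ (Fock (MvPolynomial (List Γ) ℂ) Unit Γ) :=
  Submodule.span ℂ {y | ∃ (p : MvPolynomial (List Γ) ℂ) (L : List (Unit × List Γ)) (d : ℕ),
    IsWeightedHomogeneous List.length p d ∧ p ∈ supported ℂ (lower s) ∧
    (∀ b ∈ L, b.2.Sublist s ∧ b.2.length < s.length) ∧
    d + (L.map fun b => b.2.length).sum = s.length ∧ y = p • mono _ L}

theorem smul_mono_mem_lowerTerms {s : List Γ} {p : MvPolynomial (List Γ) ℂ}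
    {L : List (Unit × List Γ)} {d : ℕ} (hp : IsWeightedHomogeneous List.length p d)
    (hp' : p ∈ supported ℂ (lower s)) (hL : ∀ b ∈ L, b.2.Sublist s ∧ b.2.length < s.length)
    (hd : d + (L.map fun b => b.2.length).sum = s.length) : p • mono _ L ∈ lowerTerms s :=
  Submodule.subset_span ⟨p, L, d, hp, hp', hL, hd, rfl⟩

/-- `lowerTerms` is only a complex span, but `f` is linear over the polynomial ring, so the
coefficient `p` of a spanning term can be pulled out. -/
theorem map_mem_lowerTerms {s t : List Γ}
    (f : Module.End (MvPolynomial (List Γ) ℂ) (Fock (MvPolynomial (List Γ) ℂ) Unit Γ))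
    (hf : ∀ (p : MvPolynomial (List Γ) ℂ) (L : List (Unit × List Γ)) (d : ℕ),
      IsWeightedHomogeneous List.length p d → p ∈ supported ℂ (lower s) →
      (∀ b ∈ L, b.2.Sublist s ∧ b.2.length < s.length) →
      d + (L.map fun b => b.2.length).sum = s.length → p • f (mono _ L) ∈ lowerTerms t)
    {y : Fock (MvPolynomial (List Γ) ℂ) Unit Γ} (hy : y ∈ lowerTerms s) : f y ∈ lowerTerms t := by
  induction hy using Submodule.span_induction with
  | mem y h =>
    obtain ⟨p, L, d, h1, h2, h3, h4, rfl⟩ := h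
    rw [map_smul]
    exact hf p L d h1 h2 h3 h4
  | zero => simp
  | add y z _ _ hy hz => rw [map_add]; exact add_mem hy hz
  | smul c y _ hy => rw [LinearMap.map_smul_of_tower]; exact Submodule.smul_mem _ _ hy

theorem rev_mem_lowerTerms {s : List Γ} {y : Fock (MvPolynomial (List Γ) ℂ) Unit Γ}
    (hy : y ∈ lowerTerms s) : rev y ∈ lowerTerms s :=
  map_mem_lowerTerms rev (fun p L d h1 h2 h3 h4 => by
    rw [rev_mono]
    exact smul_mono_mem_lowerTerms h1 h2 (fun b hb => h3 b (List.mem_reverse.1 hb))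
      (by rw [List.map_reverse, List.sum_reverse, h4])) hy

/-- Only the terms with no open block survive, and in these the coefficient carries all the letters
of `s`. -/
theorem vac_mem_of_mem_lowerTerms {s : List Γ} {y : Fock (MvPolynomial (List Γ) ℂ) Unit Γ}
    (hy : y ∈ lowerTerms s) :
    IsWeightedHomogeneous List.length (vac y) s.length ∧ vac y ∈ supported ℂ (lower s) := by
  induction hy using Submodule.span_induction with
  | mem y h =>
    obtain ⟨p, L, d, h1, h2, h3, h4, rfl⟩ := h
    cases L with
    | nil =>
      obtain rfl : d = s.length := by simpa using h4
      rw [mono_nil, map_smul, map_one, smul_eq_mul, mul_one]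
      exact ⟨h1, h2⟩
    | cons b L =>
      rw [map_smul, vac_mono_cons, smul_zero]
      exact ⟨isWeightedHomogeneous_zero _ _ _, zero_mem _⟩
  | zero => rw [map_zero]; exact ⟨isWeightedHomogeneous_zero _ _ _, zero_mem _⟩
  | add y z _ _ hy hz => rw [map_add]; exact ⟨hy.1.add hz.1, add_mem hy.2 hz.2⟩
  | smul c y _ hy =>
    have h : vac (c • y) = c • vac y :=
      LinearMap.map_smul_of_tower (vac (C := MvPolynomial (List Γ) ℂ)).toLinearMap c y
    rw [h]
    exact ⟨isWeightedHomogeneous_smul hy.1 c, Subalgebra.smul_mem _ hy.2 c⟩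

/-- A proper subword `t` of `s` becomes `i :: t`, still proper in `i :: s`. Closing this block moves
its letters from the sequence to the coefficient, so the letter count is preserved. -/
theorem joinL_mem_lowerTerms (i : Γ) {s : List Γ} {y : Fock (MvPolynomial (List Γ) ℂ) Unit Γ}
    (hy : y ∈ lowerTerms s) : joinL (genCumulant Γ) () i y ∈ lowerTerms (i :: s) := by
  refine map_mem_lowerTerms _ (fun p L d h1 h2 h3 h4 => ?_) hy
  have h2' := supported_mono (R := ℂ) (lower_subset_cons i s) h2
  cases L with
  | nil => simp [mono_nil]
  | cons b L =>
    obtain ⟨⟨⟩, t⟩ := b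
    obtain ⟨ht, htl⟩ := h3 ((), t) (by simp)
    have h3' : ∀ b ∈ L, b.2.Sublist (i :: s) ∧ b.2.length < (i :: s).length := fun b hb =>
      have := h3 b (by simp [hb])
      ⟨this.1.cons i, this.2.trans (Nat.lt_succ_self _)⟩
    have hit := cons_mem_lower i ht htl
    simp only [List.map_cons, List.sum_cons] at h4
    rw [mono_cons, joinL_mul, vac_blk, zero_smul, add_zero, joinL_blk, if_pos rfl, add_mul,
      ← mono_cons, smul_mul_assoc, one_mul, smul_add, smul_smul]
    refine add_mem (smul_mono_mem_lowerTerms h1 h2' ?_ ?_) (smul_mono_mem_lowerTerms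
      (h1.mul (isWeightedHomogeneous_X ℂ List.length (i :: t))) (mul_mem h2' ?_) h3' ?_)
    · rintro b (_ | ⟨_, hb⟩)
      · exact hit.2
      · exact h3' b hb
    · simp only [List.map_cons, List.sum_cons, List.length_cons]; omega
    · exact X_mem_supported.2 hit
    · simp only [List.length_cons]; omega

theorem joinR_mem_lowerTerms (i : Γ) {s : List Γ} {y : Fock (MvPolynomial (List Γ) ℂ) Unit Γ}
    (hy : y ∈ lowerTerms s) : joinR (genCumulant Γ) () i y ∈ lowerTerms (i :: s) := by
  rw [joinR, LinearMap.comp_apply, LinearMap.comp_apply]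
  exact rev_mem_lowerTerms (joinL_mem_lowerTerms i (rev_mem_lowerTerms hy))

theorem singleton_mem_lower (i : Γ) {s : List Γ} (hs : s ≠ []) : [i] ∈ lower (i :: s) :=
  cons_mem_lower i s.nil_sublist (List.length_pos_iff.2 hs)

/-- The hypothesis `s ≠ []` makes `[i]` a proper subword of `i :: s`. -/
theorem blk_mul_mem_lowerTerms (i : Γ) {s : List Γ} (hs : s ≠ [])
    {y : Fock (MvPolynomial (List Γ) ℂ) Unit Γ} (hy : y ∈ lowerTerms s) :
    blk _ ((), [i]) * y ∈ lowerTerms (i :: s) ∧ y * blk _ ((), [i]) ∈ lowerTerms (i :: s) := by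
  have key : ∀ (p : MvPolynomial (List Γ) ℂ) (L L' : List (Unit × List Γ)) (d : ℕ),
      IsWeightedHomogeneous List.length p d → p ∈ supported ℂ (lower s) →
      (∀ b ∈ L, b.2.Sublist s ∧ b.2.length < s.length) →
      d + (L.map fun b => b.2.length).sum = s.length → L'.Perm (((), [i]) :: L) →
      p • mono _ L' ∈ lowerTerms (i :: s) := by
    intro p L L' d h1 h2 h3 h4 h5
    refine smul_mono_mem_lowerTerms h1 (supported_mono (lower_subset_cons i s) h2) ?_ ?_
    · intro b hb
      rcases List.mem_cons.1 (h5.mem_iff.1 hb) with rfl | hb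
      · exact (singleton_mem_lower i hs).2
      · exact ⟨(h3 b hb).1.cons i, (h3 b hb).2.trans (Nat.lt_succ_self _)⟩
    · rw [(h5.map _).sum_eq]
      simp only [List.map_cons, List.sum_cons, List.length_cons, List.length_nil]; omega
  constructor
  · refine map_mem_lowerTerms (LinearMap.mulLeft _ (blk _ ((), [i])))
      (fun p L d h1 h2 h3 h4 => ?_) hy
    rw [LinearMap.mulLeft_apply, ← mono_cons]
    exact key p L _ d h1 h2 h3 h4 (List.Perm.refl _)
  · refine map_mem_lowerTerms (LinearMap.mulRight _ (blk _ ((), [i])))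
      (fun p L d h1 h2 h3 h4 => ?_) hy
    rw [LinearMap.mulRight_apply, blk, ← mono_append]
    exact key p L _ d h1 h2 h3 h4 List.perm_append_comm

theorem X_smul_mem_lowerTerms (i : Γ) {s : List Γ} (hs : s ≠ [])
    {y : Fock (MvPolynomial (List Γ) ℂ) Unit Γ} (hy : y ∈ lowerTerms s) :
    (X [i] : MvPolynomial (List Γ) ℂ) • y ∈ lowerTerms (i :: s) := by
  refine map_mem_lowerTerms (LinearMap.lsmul _ _ (X [i] : MvPolynomial (List Γ) ℂ))
      (fun p L d h1 h2 h3 h4 => ?_) hy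
  rw [LinearMap.lsmul_apply, smul_smul]
  refine smul_mono_mem_lowerTerms (h1.mul (isWeightedHomogeneous_X ℂ List.length [i]))
    (mul_mem (supported_mono (lower_subset_cons i s) h2)
      (X_mem_supported.2 (singleton_mem_lower i hs)))
    (fun b hb => ⟨(h3 b hb).1.cons i, (h3 b hb).2.trans (Nat.lt_succ_self _)⟩) ?_
  simp only [List.length_cons, List.length_nil]; omega

theorem op_mem_lowerTerms (γ : I ⊕ J) {s : List (I ⊕ J)} (hs : s ≠ [])
    {y : Fock (MvPolynomial (List (I ⊕ J)) ℂ) Unit (I ⊕ J)} (hy : y ∈ lowerTerms s) :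
    op (genCumulant _) () γ y ∈ lowerTerms (γ :: s) := by
  cases γ with
  | inl i =>
    exact add_mem (add_mem (blk_mul_mem_lowerTerms _ hs hy).1 (X_smul_mem_lowerTerms _ hs hy))
      (joinL_mem_lowerTerms _ hy)
  | inr j =>
    exact add_mem (add_mem (blk_mul_mem_lowerTerms _ hs hy).2 (X_smul_mem_lowerTerms _ hs hy))
      (joinR_mem_lowerTerms _ hy)

theorem smul_blk_mem_lowerTerms {s : List Γ} (p : MvPolynomial (List Γ) ℂ)
    (t : List Γ) {d : ℕ} (hp : IsWeightedHomogeneous List.length p d)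
    (hp' : p ∈ supported ℂ (lower s)) (ht : t.Sublist s) (htl : t.length < s.length)
    (hd : d + t.length = s.length) : p • blk _ ((), t) ∈ lowerTerms s :=
  smul_mono_mem_lowerTerms hp hp' (by simpa using ⟨ht, htl⟩) (by simpa using hd)

/-- Joining the full block `s` reproduces the leading part for `γ :: s`. The four by-products come
from `γ` forming its own block, open or closed, next to `s`, open or closed. -/
theorem op_leading_mem_lowerTerms (γ : I ⊕ J) {s : List (I ⊕ J)} (hs : s ≠ []) :
    op (genCumulant _) () γ
        (blk _ ((), s) + (X s : MvPolynomial (List (I ⊕ J)) ℂ) • 1) -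
      (blk _ ((), γ :: s) + (X (γ :: s) : MvPolynomial (List (I ⊕ J)) ℂ) • 1) ∈
      lowerTerms (γ :: s) := by
  have hs' : s ∈ lower (γ :: s) := ⟨hs, List.sublist_cons_self _ _, by simp⟩
  have hγ := singleton_mem_lower γ hs
  have h1 : ∀ L : List (Unit × List (I ⊕ J)), L.Perm [((), [γ]), ((), s)] →
      mono _ L ∈ lowerTerms (γ :: s) := by
    intro L hL
    rw [← one_smul (MvPolynomial (List (I ⊕ J)) ℂ) (mono _ L)]
    refine smul_mono_mem_lowerTerms (isWeightedHomogeneous_one ℂ _) (one_mem _) ?_ ?_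
    · intro b hb
      have := hL.mem_iff.1 hb
      simp only [List.mem_cons, List.not_mem_nil, or_false] at this
      rcases this with rfl | rfl
      exacts [hγ.2, hs'.2]
    · rw [(hL.map _).sum_eq]; simp; omega
  have h2 : (X [γ] : MvPolynomial (List (I ⊕ J)) ℂ) • blk _ ((), s) ∈ lowerTerms (γ :: s) :=
    smul_blk_mem_lowerTerms _ _ (isWeightedHomogeneous_X ℂ List.length [γ])
      (X_mem_supported.2 hγ) hs'.2.1 hs'.2.2 (by simp; omega)
  have h3 : (X s : MvPolynomial (List (I ⊕ J)) ℂ) • blk _ ((), [γ]) ∈ lowerTerms (γ :: s) :=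
    smul_blk_mem_lowerTerms _ _ (isWeightedHomogeneous_X ℂ List.length s)
      (X_mem_supported.2 hs') hγ.2.1 hγ.2.2 (by simp)
  have h4 : (X s * X [γ] : MvPolynomial (List (I ⊕ J)) ℂ) •
      (1 : Fock (MvPolynomial (List (I ⊕ J)) ℂ) Unit (I ⊕ J)) ∈ lowerTerms (γ :: s) := by
    rw [← mono_nil]
    exact smul_mono_mem_lowerTerms ((isWeightedHomogeneous_X ℂ List.length s).mul
      (isWeightedHomogeneous_X ℂ List.length [γ]))
      (mul_mem (X_mem_supported.2 hs') (X_mem_supported.2 hγ)) (by simp) (by simp)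
  cases γ with
  | inl i =>
    have h0 := h1 [((), [Sum.inl i]), ((), s)] (List.Perm.refl _)
    rw [mono_cons, mono_singleton] at h0
    convert add_mem (add_mem h0 h2) (add_mem h3 h4) using 1
    rw [op, map_add, map_smul, opL_apply, opL_apply, joinL_blk, joinL_one, if_pos rfl, smul_add,
      smul_add, smul_smul, mul_one, smul_zero]
    abel
  | inr j =>
    have h0 := h1 [((), s), ((), [Sum.inr j])] (List.Perm.swap _ _ _)
    rw [mono_cons, mono_singleton] at h0
    convert add_mem (add_mem h0 h2) (add_mem h3 h4) using 1
    rw [op, map_add, map_smul, opR_apply, opR_apply, joinR_blk, joinR_one, if_pos rfl, smul_add,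
      smul_add, smul_smul, one_mul, smul_zero]
    abel

/-- The two leading terms are the single block with all the letters, left open or closed; every
other grouping uses proper subwords only. -/
theorem vec_sub_mem_lowerTerms {s : List (I ⊕ J)} (hs : s ≠ []) :
    vec (genCumulant (I ⊕ J)) () s -
      (blk _ ((), s) + (X s : MvPolynomial (List (I ⊕ J)) ℂ) • 1) ∈ lowerTerms s := by
  induction s with
  | nil => exact absurd rfl hs
  | cons γ s ih =>
    by_cases hs' : s = []
    · subst hs'
      convert zero_mem (lowerTerms [γ]) using 1
      cases γ <;> simp [vec, op, opL_apply, opR_apply]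
    · have h := add_mem (op_mem_lowerTerms γ hs' (ih hs')) (op_leading_mem_lowerTerms γ hs')
      rw [map_sub] at h
      convert h using 1
      rw [vec]; abel

/-- The universal polynomial giving the moments in terms of the cumulants. -/
noncomputable def momentPoly (s : List (I ⊕ J)) : MvPolynomial (List (I ⊕ J)) ℂ :=
  vac (vec (genCumulant (I ⊕ J)) () s)

/-- The part of `momentPoly s` which involves the cumulants of proper subwords. -/
noncomputable def momentRest (s : List (I ⊕ J)) : MvPolynomial (List (I ⊕ J)) ℂ :=
  momentPoly s - X s

theorem momentPoly_eq (s : List (I ⊕ J)) : momentPoly s = X s + momentRest s := by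
  simp [momentRest]

theorem momentRest_spec {s : List (I ⊕ J)} (hs : s ≠ []) :
    IsWeightedHomogeneous List.length (momentRest s) s.length ∧
      momentRest s ∈ supported ℂ (lower s) := by
  have h := vac_mem_of_mem_lowerTerms (vec_sub_mem_lowerTerms hs)
  rwa [map_sub, map_add, vac_blk, map_smul, map_one, smul_eq_mul, mul_one, zero_add] at h

theorem isWeightedHomogeneous_momentPoly {s : List (I ⊕ J)} (hs : s ≠ []) :
    IsWeightedHomogeneous List.length (momentPoly s) s.length := by
  rw [momentPoly_eq]
  exact (isWeightedHomogeneous_X ℂ List.length s).add (momentRest_spec hs).1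

end Universal

/-! ### Inversion: cumulants as universal polynomials in the moments. -/

section Cumulants

open MvPolynomial

variable {Γ I J : Type*}

/-- The universal polynomial giving the cumulants in terms of the moments. -/
noncomputable def cumulantPoly (s : List (I ⊕ J)) : MvPolynomial (List (I ⊕ J)) ℂ :=
  -- The guard serves termination. For nonempty `s` the default `0` is never used, since `momentRest
  -- s` involves only nonempty shorter subwords.
  X s - aeval (fun t => if _h : t ≠ [] ∧ t.length < s.length then cumulantPoly t else 0)
    (momentRest s)
termination_by s.length
decreasing_by exact _h.2

theorem isWeightedHomogeneous_cumulantPoly (s : List (I ⊕ J)) (hs : s ≠ []) :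
    IsWeightedHomogeneous List.length (cumulantPoly s) s.length := by
  rw [cumulantPoly]
  refine (isWeightedHomogeneous_X ℂ List.length s).sub
    (isWeightedHomogeneous_aeval (fun t => ?_) (momentRest_spec hs).1)
  split_ifs with h
  · exact isWeightedHomogeneous_cumulantPoly t h.1
  · exact isWeightedHomogeneous_zero _ _ _
termination_by s.length
decreasing_by exact h.2

theorem lower_subset_lower {s t : List Γ} (h : t ∈ lower s) : lower t ⊆ lower s :=
  fun _ hr => ⟨hr.1, hr.2.1.trans h.2.1, hr.2.2.trans h.2.2⟩

theorem cumulantPoly_sub_mem_supported (s : List (I ⊕ J)) (hs : s ≠ []) :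
    cumulantPoly s - X s ∈ supported ℂ (lower s) := by
  rw [cumulantPoly, sub_sub_cancel_left]
  refine neg_mem (aeval_mem_supported (fun t ht => ?_) (momentRest_spec hs).2)
  rw [dif_pos ⟨ht.1, ht.2.2⟩, ← sub_add_cancel (cumulantPoly t) (X t)]
  have := ht.2.2
  exact add_mem (supported_mono (lower_subset_lower ht) (cumulantPoly_sub_mem_supported t ht.1))
    (X_mem_supported.2 ht)
termination_by s.length

theorem aeval_cumulantPoly_momentPoly {s : List (I ⊕ J)} (hs : s ≠ []) :
    aeval cumulantPoly (momentPoly s) = X s := by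
  rw [momentPoly_eq, map_add, aeval_X, cumulantPoly, sub_add_eq_add_sub, sub_eq_iff_eq_add]
  refine congrArg (X s + ·) ?_
  refine aeval_congr_of_mem_supported (fun t ht => ?_) (momentRest_spec hs).2
  rw [dif_pos ⟨ht.1, ht.2.2⟩]

/-- The cumulants of a family with given moments. -/
noncomputable def cumulants (m : List (I ⊕ J) → ℂ) (s : List (I ⊕ J)) : ℂ :=
  aeval m (cumulantPoly s)

theorem aeval_cumulants_momentPoly (m : List (I ⊕ J) → ℂ) {s : List (I ⊕ J)} (hs : s ≠ []) :
    aeval (cumulants m) (momentPoly s) = m s := by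
  have h := congrArg (aeval m) (aeval_cumulantPoly_momentPoly hs)
  rwa [aeval_X, comp_aeval_apply] at h

theorem aeval_momentPoly_congr {κ κ' : List (I ⊕ J) → ℂ} {s : List (I ⊕ J)} (hs : s ≠ [])
    (h : ∀ t ≠ [], t.Sublist s → κ t = κ' t) :
    aeval κ (momentPoly s) = aeval κ' (momentPoly s) := by
  rw [momentPoly_eq, map_add, map_add, aeval_X, aeval_X, h s hs (List.Sublist.refl s)]
  exact congrArg _ (aeval_congr_of_mem_supported (fun t ht => h t ht.1 ht.2.1)
    (momentRest_spec hs).2)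

/-- By induction on the length the cumulants of the shorter subwords agree, hence so do the
remainders, and the leading variable can be cancelled. -/
theorem momentPoly_inj {κ κ' : List (I ⊕ J) → ℂ} (s : List (I ⊕ J)) (hs : s ≠ [])
    (h : ∀ t ≠ [], t.Sublist s → aeval κ (momentPoly t) = aeval κ' (momentPoly t)) :
    κ s = κ' s := by
  have h' := h s hs (List.Sublist.refl s)
  rw [momentPoly_eq, map_add, map_add, aeval_X, aeval_X,
    aeval_congr_of_mem_supported (g := κ') (fun t ht => ?_) (momentRest_spec hs).2] at h'
  · exact add_right_cancel h'
  · have := ht.2.2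
    exact momentPoly_inj t ht.1 fun r hr hrt => h r hr (hrt.trans ht.2.1)
termination_by s.length

theorem cumulants_eq {m κ : List (I ⊕ J) → ℂ} {s : List (I ⊕ J)} (hs : s ≠ [])
    (h : ∀ t ≠ [], t.Sublist s → aeval κ (momentPoly t) = m t) : cumulants m s = κ s :=
  momentPoly_inj s hs fun t ht hts => by rw [aeval_cumulants_momentPoly m ht, h t ht hts]

end Cumulants

/-! ### Additivity: forgetting colours adds cumulants. -/

section Specialize

open MvPolynomial Fock

variable {Γ I J K : Type*} (κ : K → List Γ → ℂ) (S : Finset K)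

/-- The ring homomorphism which applies `e` to the coefficients and `g` to the blocks. -/
noncomputable def substitute {C D B A : Type*} [CommRing C] [CommRing D] [Ring A] [Algebra D A]
    (e : C →+* D) (g : B → A) : MonoidAlgebra C (FreeMonoid B) →+* A :=
  MonoidAlgebra.liftNCRingHom ((algebraMap D A).comp e) (FreeMonoid.lift g)
    fun _ _ => Algebra.commute_algebraMap_left _ _

theorem substitute_of {C D B A : Type*} [CommRing C] [CommRing D] [Ring A] [Algebra D A]
    (e : C →+* D) (g : B → A) (b : B) :
    substitute e g (MonoidAlgebra.of C _ (FreeMonoid.of b)) = g b := by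
  rw [substitute, MonoidAlgebra.of_apply, MonoidAlgebra.liftNCRingHom_single, map_one, one_mul]
  exact FreeMonoid.lift_eval_of _ _

theorem substitute_smul {C D B A : Type*} [CommRing C] [CommRing D] [Ring A] [Algebra D A]
    (e : C →+* D) (g : B → A) (p : C) (a : MonoidAlgebra C (FreeMonoid B)) :
    substitute e g (p • a) = e p • substitute e g a := by
  rw [Algebra.smul_def (e p)]
  exact MonoidAlgebra.liftNC_smul _ _ _ _

/-- The specialization of the universal cumulants to the sum of the cumulants of the colours in `S`,
each uncoloured block being replaced by the sum of its colourings. -/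
noncomputable def specialize : Fock (MvPolynomial (List Γ) ℂ) Unit Γ →+* Fock ℂ K Γ :=
  substitute (aeval (∑ k ∈ S, κ k) : MvPolynomial (List Γ) ℂ →ₐ[ℂ] ℂ).toRingHom
    fun b => ∑ k ∈ S, blk ℂ (k, b.2)

variable {κ S}

theorem specialize_blk (b : Unit × List Γ) :
    specialize κ S (blk _ b) = ∑ k ∈ S, blk ℂ (k, b.2) :=
  substitute_of _ _ _

theorem specialize_smul (p : MvPolynomial (List Γ) ℂ)
    (a : Fock (MvPolynomial (List Γ) ℂ) Unit Γ) :
    specialize κ S (p • a) = aeval (∑ k ∈ S, κ k) p • specialize κ S a :=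
  substitute_smul _ _ _ _

theorem specialize_rev (a : Fock (MvPolynomial (List Γ) ℂ) Unit Γ) :
    specialize κ S (rev a) = rev (specialize κ S a) := by
  induction a using induction_mono with
  | hm L =>
    induction L with
    | nil => simp [mono_nil]
    | cons b L ih =>
      rw [mono_cons, rev_mul, map_mul, map_mul, ih, rev_mul, rev_blk, specialize_blk]
      simp only [map_sum, rev_blk]
  | hadd a b h h' => simp only [map_add, h, h']
  | hsmul p a h => simp only [map_smul, specialize_smul, h]

/-- Colouring sends the empty sequence to itself and nonempty sequences to sums of nonempty ones. -/
theorem vac_specialize (a : Fock (MvPolynomial (List Γ) ℂ) Unit Γ) :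
    vac (specialize κ S a) = aeval (∑ k ∈ S, κ k) (vac a) := by
  induction a using induction_mono with
  | hm L =>
    cases L with
    | nil => simp [mono_nil]
    | cons b L => simp [mono_cons, specialize_blk]
  | hadd a b h h' => simp only [map_add, h, h']
  | hsmul p a h => simp only [map_smul, specialize_smul, h, smul_eq_mul, map_mul]

variable [DecidableEq K]

/-- Each colouring of the first block is joined by exactly one colour of the letter, its own.
Closing the block therefore produces the sum of the `κ k` over `S`, which is the specialized
cumulant. -/
theorem specialize_joinL (i : Γ) (a : Fock (MvPolynomial (List Γ) ℂ) Unit Γ) :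
    specialize κ S (joinL (genCumulant Γ) () i a) = ∑ k ∈ S, joinL κ k i (specialize κ S a) := by
  induction a using induction_mono with
  | hm L =>
    cases L with
    | nil => simp [mono_nil]
    | cons b L =>
      simp only [mono_cons, joinL_mul, vac_blk, zero_smul, add_zero, map_mul, map_sum, joinL_blk,
        if_true, map_add, specialize_blk, specialize_smul, map_one, aeval_X, Finset.sum_const_zero,
        Finset.sum_ite_eq', ← Finset.sum_mul]
      congr 1
      rw [Finset.sum_congr rfl fun k hk => if_pos hk, Finset.sum_add_distrib, Finset.sum_apply,
        Finset.sum_smul]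
  | hadd a b h h' => simp only [map_add, h, h', Finset.sum_add_distrib]
  | hsmul p a h => simp only [map_smul, specialize_smul, h, Finset.smul_sum]

theorem specialize_joinR (i : Γ) (a : Fock (MvPolynomial (List Γ) ℂ) Unit Γ) :
    specialize κ S (joinR (genCumulant Γ) () i a) = ∑ k ∈ S, joinR κ k i (specialize κ S a) := by
  simp only [joinR, LinearMap.comp_apply, specialize_rev, specialize_joinL, map_sum]

theorem specialize_op {κ : K → List (I ⊕ J) → ℂ} (γ : I ⊕ J)
    (a : Fock (MvPolynomial (List (I ⊕ J)) ℂ) Unit (I ⊕ J)) :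
    specialize κ S (op (genCumulant _) () γ a) = (∑ k ∈ S, op κ k γ) (specialize κ S a) := by
  rw [LinearMap.sum_apply]
  cases γ with
  | inl i =>
    simp only [op, opL_apply, map_add, map_mul, specialize_joinL, specialize_blk, specialize_smul,
      aeval_X, Finset.sum_add_distrib, Finset.sum_mul, Finset.sum_apply, Finset.sum_smul]
  | inr j =>
    simp only [op, opR_apply, map_add, map_mul, specialize_joinR, specialize_blk, specialize_smul,
      aeval_X, Finset.sum_add_distrib, Finset.mul_sum, Finset.sum_apply, Finset.sum_smul]

theorem specialize_vec (κ : K → List (I ⊕ J) → ℂ) (S : Finset K) (s : List (I ⊕ J)) :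
    specialize κ S (vec (genCumulant _) () s) = (s.map fun γ => ∑ k ∈ S, op κ k γ).prod 1 := by
  induction s with
  | nil => simp [vec]
  | cons γ s ih => rw [vec, specialize_op, ih, List.map_cons, List.prod_cons, Module.End.mul_apply]

/-- The moments of the sum of the families of operators of the colours in `S`. -/
theorem vac_sum_op (κ : K → List (I ⊕ J) → ℂ) (S : Finset K) (s : List (I ⊕ J)) :
    vac ((s.map fun γ => ∑ k ∈ S, op κ k γ).prod 1) =
      aeval (∑ k ∈ S, κ k) (momentPoly s) := by
  rw [← specialize_vec, vac_specialize, momentPoly]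

theorem vec_eq_prod (κ : K → List (I ⊕ J) → ℂ) (k : K) (s : List (I ⊕ J)) :
    vec κ k s = (s.map (op κ k)).prod 1 := by
  induction s with
  | nil => rfl
  | cons γ s ih => rw [vec, ih, List.map_cons, List.prod_cons, Module.End.mul_apply]

theorem vac_vec (κ : K → List (I ⊕ J) → ℂ) (k : K) (s : List (I ⊕ J)) :
    vac (vec κ k s) = aeval (κ k) (momentPoly s) := by
  have h := vac_sum_op κ {k} s
  simpa only [Finset.sum_singleton, vec_eq_prod] using h

end Specialize

/-! ### The free product on elementary tensors. -/

section FreeProductVectors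

variable {K : Type v} (X : K → StateSpace.{u})

namespace StateSpace

/-- The projection onto `𝒳°` along `ξ`. -/
def toCirc (Y : StateSpace.{u}) (y : Y.carrier) : Y.circ := ⟨y - Y.ψ y • Y.ξ, by simp [Y.ψ_ξ]⟩

theorem toCirc_ξ (Y : StateSpace.{u}) : Y.toCirc Y.ξ = 0 := by
  ext; simp [toCirc, Y.ψ_ξ]

theorem toCirc_coe (Y : StateSpace.{u}) (y : Y.circ) : Y.toCirc y = y := by
  have h : Y.ψ (y : Y.carrier) = 0 := y.2
  ext; simp [toCirc, h]

end StateSpace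

theorem gather_apply {α β γ : Type v} (f : α → γ) (g : β → γ)
    (hfg : Function.Bijective (Sum.elim f g)) (M : γ → Type u) (P : α → Type u) (Q : β → Type u)
    [∀ c, AddCommGroup (M c)] [∀ c, Module ℂ (M c)] [∀ a, AddCommGroup (P a)]
    [∀ a, Module ℂ (P a)] [∀ b, AddCommGroup (Q b)] [∀ b, Module ℂ (Q b)]
    (η : ∀ a, P a ≃ₗ[ℂ] M (f a)) (θ : ∀ b, Q b ≃ₗ[ℂ] M (g b)) (p : ⨁ a, P a) (q : ⨁ b, Q b) :
    gather f g hfg M P Q η θ (p, q) = inject f M P η p + inject g M Q θ q := rfl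

open Classical in
/-- The inclusion of the summand of an alternating word in the free product. -/
noncomputable def summand (s : AltWord K) : tensorWord X s.1 →ₗ[ℂ] FreeSpace X :=
  DirectSum.lof ℂ (AltWord K) (fun s => tensorWord X s.1) s

open Classical in
/-- The inclusion of a summand in `𝒳(l, i)`. -/
noncomputable def summandL (i : K) (s : AltWordL i) : tensorWord X s.1.1 →ₗ[ℂ] FreeSpaceL X i :=
  DirectSum.lof ℂ (AltWordL i) (fun s => tensorWord X s.1.1) s

open Classical in
/-- The inclusion of a summand in `𝒳(r, i)`. -/
noncomputable def summandR (i : K) (s : AltWordR i) : tensorWord X s.1.1 →ₗ[ℂ] FreeSpaceR X i :=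
  DirectSum.lof ℂ (AltWordR i) (fun s => tensorWord X s.1.1) s

theorem V_tmul (i : K) (s : AltWordL i) (y : (X i).carrier) (t : tensorWord X s.1.1) :
    V X i (y ⊗ₜ summandL X i s t) = (X i).ψ y • summand X s.1 t +
      summand X (consWord i s) (consEquiv X i s.1.1 ((X i).toCirc y ⊗ₜ t)) := by
  classical
  rw [V, summandL]
  simp only [LinearEquiv.trans_apply, TensorProduct.congr_tmul, LinearEquiv.refl_apply]
  rw [show (X i).split y = ((X i).ψ y, (X i).toCirc y) from rfl, TensorProduct.prodLeft_tmul]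
  rw [LinearEquiv.prodCongr_apply, TensorProduct.lid_tmul, TensorProduct.directSumRight_tmul_lof]
  rw [gather_apply, map_smul]
  congr 1
  · rw [inject_lof]; rfl
  · exact inject_lof _ _ _ _ _ _

theorem W_tmul (i : K) (s : AltWordR i) (y : (X i).carrier) (t : tensorWord X s.1.1) :
    W X i (summandR X i s t ⊗ₜ y) = (X i).ψ y • summand X s.1 t +
      summand X (snocWord i s) (snocEquiv X i s.1.1 (t ⊗ₜ (X i).toCirc y)) := by
  classical
  rw [W, summandR]
  simp only [LinearEquiv.trans_apply, TensorProduct.congr_tmul, LinearEquiv.refl_apply]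
  rw [show (X i).split y = ((X i).ψ y, (X i).toCirc y) from rfl, TensorProduct.prodRight_tmul]
  rw [LinearEquiv.prodCongr_apply, TensorProduct.rid_tmul, TensorProduct.directSumLeft_tmul_lof]
  rw [gather_apply, map_smul]
  congr 1
  · rw [inject_lof]; rfl
  · exact inject_lof _ _ _ _ _ _

theorem leftRep_V (i : K) (T : Module.End ℂ (X i).carrier) (y : (X i).carrier)
    (a : FreeSpaceL X i) : leftRep X i T (V X i (y ⊗ₜ a)) = V X i (T y ⊗ₜ a) := by
  change V X i (LinearMap.rTensor _ T ((V X i).symm (V X i (y ⊗ₜ a)))) = _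
  rw [LinearEquiv.symm_apply_apply, LinearMap.rTensor_tmul]

theorem rightRep_W (i : K) (T : Module.End ℂ (X i).carrier) (y : (X i).carrier)
    (a : FreeSpaceR X i) : rightRep X i T (W X i (a ⊗ₜ y)) = W X i (a ⊗ₜ T y) := by
  change W X i (LinearMap.lTensor _ T ((W X i).symm (W X i (a ⊗ₜ y)))) = _
  rw [LinearEquiv.symm_apply_apply, LinearMap.lTensor_tmul]

theorem V_ξ_tmul (i : K) (s : AltWordL i) (t : tensorWord X s.1.1) :
    V X i ((X i).ξ ⊗ₜ summandL X i s t) = summand X s.1 t := by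
  rw [V_tmul, StateSpace.toCirc_ξ, (X i).ψ_ξ, TensorProduct.zero_tmul]; simp

theorem W_ξ_tmul (i : K) (s : AltWordR i) (t : tensorWord X s.1.1) :
    W X i (summandR X i s t ⊗ₜ (X i).ξ) = summand X s.1 t := by
  rw [W_tmul, StateSpace.toCirc_ξ, (X i).ψ_ξ, TensorProduct.tmul_zero]; simp

theorem V_circ_tmul (i : K) (s : AltWordL i) (y : (X i).circ) (t : tensorWord X s.1.1) :
    V X i ((y : (X i).carrier) ⊗ₜ summandL X i s t) =
      summand X (consWord i s) (consEquiv X i s.1.1 (y ⊗ₜ t)) := by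
  have h : (X i).ψ (y : (X i).carrier) = 0 := y.2
  rw [V_tmul, StateSpace.toCirc_coe, h, zero_smul, zero_add]

theorem W_circ_tmul (i : K) (s : AltWordR i) (y : (X i).circ) (t : tensorWord X s.1.1) :
    W X i (summandR X i s t ⊗ₜ (y : (X i).carrier)) =
      summand X (snocWord i s) (snocEquiv X i s.1.1 (t ⊗ₜ y)) := by
  have h : (X i).ψ (y : (X i).carrier) = 0 := y.2
  rw [W_tmul, StateSpace.toCirc_coe, h, zero_smul, zero_add]

end FreeProductVectors

/-! ### The correspondence between the free product and an algebra. -/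

section Correspondence

variable {K : Type v} {X : K → StateSpace.{u}} {A : Type w} [Ring A] [Algebra ℂ A]

/-- Elementary tensors `x₁ ⊗ ⋯ ⊗ xₙ` paired with products `a₁ ⋯ aₙ`, where `(x_j, a_j)` lies in a
given set of pairs. -/
inductive TensorRel (R : ∀ k, Submodule ℂ ((X k).carrier × A)) :
    (s : List K) → tensorWord X s → A → Prop
  | nil : TensorRel R [] ((nilEquiv X).symm 1) 1
  | cons (k : K) (s : List K) (y : (X k).circ) (a : A) (t : tensorWord X s) (b : A)
      (hy : ((y : (X k).carrier), a) ∈ R k) (ht : TensorRel R s t b) :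
      TensorRel R (k :: s) (consEquiv X k s (y ⊗ₜ t)) (a * b)

variable {R : ∀ k, Submodule ℂ ((X k).carrier × A)}

theorem TensorRel.snoc {s : List K} {t : tensorWord X s} {b : A} (ht : TensorRel R s t b) (k : K)
    (y : (X k).circ) (a : A) (hy : ((y : (X k).carrier), a) ∈ R k) :
    TensorRel R (s ++ [k]) (snocEquiv X k s (t ⊗ₜ y)) (b * a) := by
  induction ht with
  | nil =>
    have h := TensorRel.cons k [] y a _ _ hy TensorRel.nil
    rw [mul_one] at h
    rw [one_mul]
    exact h
  | cons c s z d t b hz ht ih =>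
    rw [mul_assoc]
    exact TensorRel.cons c _ z d _ _ hz ih

/-- `TensorRel` grows on the left, while right representations act on the last tensor factor, which
is exposed here. -/
theorem TensorRel.exists_snoc (k : K) : ∀ (s : List K) (t : tensorWord X (s ++ [k])) (b : A),
    TensorRel R (s ++ [k]) t b → ∃ (t' : tensorWord X s) (b' : A) (y : (X k).circ) (a : A),
      ((y : (X k).carrier), a) ∈ R k ∧ TensorRel R s t' b' ∧
      t = snocEquiv X k s (t' ⊗ₜ y) ∧ b = b' * a := by
  intro s
  induction s with
  | nil =>
    intro t b h
    cases h with
    | cons _ _ y a t b hy ht =>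
      cases ht
      exact ⟨_, 1, y, a, hy, TensorRel.nil, rfl, by simp⟩
  | cons c s ih =>
    intro t b h
    cases h with
    | cons _ _ z d t b hz ht =>
      obtain ⟨t', b', y, a, hy, ht', rfl, rfl⟩ := ih t b ht
      exact ⟨_, _, y, a, hy, TensorRel.cons c s z d t' b' hz ht', rfl, by rw [mul_assoc]⟩

end Correspondence

section Correspondence

variable {K : Type v} {X : K → StateSpace.{u}} {A : Type w} [Ring A] [Algebra ℂ A]

/-- The linear correspondence between the free product and `A` spanned by the pairs
`(x₁ ⊗ ⋯ ⊗ xₙ, a₁ ⋯ aₙ)`. -/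
noncomputable def tensorSpan (R : ∀ k, Submodule ℂ ((X k).carrier × A)) :
    Submodule ℂ (FreeSpace X × A) :=
  Submodule.span ℂ {p | ∃ (s : AltWord K) (t : tensorWord X s.1) (b : A),
    TensorRel R s.1 t b ∧ p = (summand X s t, b)}

variable {R : ∀ k, Submodule ℂ ((X k).carrier × A)}

theorem mem_tensorSpan {s : AltWord K} {t : tensorWord X s.1} {b : A} (h : TensorRel R s.1 t b) :
    (summand X s t, b) ∈ tensorSpan R :=
  Submodule.subset_span ⟨s, t, b, h, rfl⟩

theorem map_mem_tensorSpan (F : Module.End ℂ (FreeSpace X)) (θ : Module.End ℂ A)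
    (h : ∀ (s : AltWord K) (t : tensorWord X s.1) (b : A), TensorRel R s.1 t b →
      (F (summand X s t), θ b) ∈ tensorSpan R) {p : FreeSpace X × A} (hp : p ∈ tensorSpan R) :
    (F p.1, θ p.2) ∈ tensorSpan R := by
  induction hp using Submodule.span_induction with
  | mem p hp =>
    obtain ⟨s, t, b, ht, rfl⟩ := hp
    exact h s t b ht
  | zero =>
    rw [Prod.fst_zero, Prod.snd_zero, map_zero, map_zero]
    exact zero_mem _
  | add p q _ _ hp hq => simpa using add_mem hp hq
  | smul c p _ hp => simpa using Submodule.smul_mem _ c hp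

variable (ε : A →ₐ[ℂ] ℂ) (hR : ∀ k, ∀ p ∈ R k, (X k).ψ p.1 = ε p.2)
  (hξ : ∀ k, ((X k).ξ, (1 : A)) ∈ R k)

-- In a nonempty elementary tensor the first factor lies in `𝒳°`, so its partner is killed by the
-- character `ε`, and with it the whole product; the tensor itself has no vacuum component.
include hR in
theorem ψ_eq_of_mem_tensorSpan {p : FreeSpace X × A} (hp : p ∈ tensorSpan R) :
    (freeProduct X).ψ p.1 = ε p.2 := by
  classical
  induction hp using Submodule.span_induction with
  | mem p hp =>
    obtain ⟨⟨s, hs⟩, t, b, ht, rfl⟩ := hp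
    dsimp only at ht t
    cases ht with
    | nil =>
      exact (freeProduct X).ψ_ξ.trans (map_one ε).symm
    | cons k s y a t b hy ht =>
      have h0 : ε a = 0 := (hR k _ hy).symm.trans y.2
      rw [map_mul, h0, zero_mul]
      change nilEquiv X (DirectSum.component ℂ (AltWord K) (fun s => tensorWord X s.1)
        ⟨[], List.isChain_nil⟩ (DirectSum.lof ℂ (AltWord K) (fun s => tensorWord X s.1) _ _)) = 0
      rw [DirectSum.component.of, dif_neg (by simp), map_zero]
  | zero => simp
  | add p q _ _ hp hq => simp only [Prod.fst_add, Prod.snd_add, map_add, hp, hq]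
  | smul c p _ hp => simp only [Prod.smul_fst, Prod.smul_snd, map_smul, hp]

include hR hξ in
theorem toCirc_mem (i : K) {y : (X i).carrier} {c : A} (hy : (y, c) ∈ R i) :
    (((X i).toCirc y : (X i).carrier), c - ε c • 1) ∈ R i := by
  have h := sub_mem hy (Submodule.smul_mem _ (ε c) (hξ i))
  rw [← hR i _ hy] at h ⊢
  exact h

-- Split `y` into its `ξ` and `𝒳°` components and `c` into `ε c • 1` and the rest; by `toCirc_mem`
-- the splittings correspond, and each piece is a spanning pair.
include hR hξ in
theorem V_mem_tensorSpan (i : K) (s : AltWordL i) {t : tensorWord X s.1.1} {b : A}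
    (ht : TensorRel R s.1.1 t b) {y : (X i).carrier} {c : A} (hy : (y, c) ∈ R i) :
    (V X i (y ⊗ₜ summandL X i s t), c * b) ∈ tensorSpan R := by
  have h := add_mem (Submodule.smul_mem _ (ε c) (mem_tensorSpan ht))
    (mem_tensorSpan (s := consWord i s)
      (TensorRel.cons i _ _ _ _ _ (toCirc_mem ε hR hξ i hy) ht))
  rw [V_tmul, hR i _ hy]
  convert h using 1
  rw [Prod.smul_mk, Prod.mk_add_mk, sub_mul, smul_mul_assoc, one_mul, add_sub_cancel]

include hR hξ in
theorem W_mem_tensorSpan (i : K) (s : AltWordR i) {t : tensorWord X s.1.1} {b : A}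
    (ht : TensorRel R s.1.1 t b) {y : (X i).carrier} {c : A} (hy : (y, c) ∈ R i) :
    (W X i (summandR X i s t ⊗ₜ y), b * c) ∈ tensorSpan R := by
  have h := add_mem (Submodule.smul_mem _ (ε c) (mem_tensorSpan ht))
    (mem_tensorSpan (s := snocWord i s) (ht.snoc i _ _ (toCirc_mem ε hR hξ i hy)))
  rw [W_tmul, hR i _ hy]
  convert h using 1
  rw [Prod.smul_mk, Prod.mk_add_mk, mul_sub, mul_smul_comm, mul_one, add_sub_cancel]

-- A word beginning with `i` has its first factor moved by `T`, matched by `hθ`. Any other word is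
-- `ξ ⊗ t`, and `T` acts on that `ξ`; the partner must then satisfy `θ b = θ 1 * b`, which follows
-- from `hθ'` on the first factor.
include hR hξ in
theorem leftRep_mem_tensorSpan (i : K) (T : Module.End ℂ (X i).carrier) (θ : Module.End ℂ A)
    (hT : ∀ p ∈ R i, (T p.1, θ p.2) ∈ R i) (hθ : ∀ a b, ε a = 0 → θ (a * b) = θ a * b)
    (hθ' : ∀ k ≠ i, ∀ p ∈ R k, θ p.2 = θ 1 * p.2) {p : FreeSpace X × A} (hp : p ∈ tensorSpan R) :
    (leftRep X i T p.1, θ p.2) ∈ tensorSpan R := by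
  refine map_mem_tensorSpan _ θ (fun s t b ht => ?_) hp
  obtain ⟨s | s, rfl⟩ := (bijective_consWord i).2 s
  · change tensorWord X s.1.1 at t
    change TensorRel R s.1.1 t b at ht
    -- The first letter of the word differs from `i`, so its factor falls under `hθ'`, after `hθ`
    -- has isolated it.
    have hb : θ b = θ 1 * b := by
      obtain ⟨⟨s, hs⟩, hs'⟩ := s
      dsimp only at ht t hs'
      cases ht with
      | nil => rw [mul_one]
      | cons k s y a t b hy ht =>
        have hk : k ≠ i := fun h => hs' (by rw [h]; rfl)
        rw [hθ _ _ ((hR k _ hy).symm.trans y.2), hθ' k hk _ hy, mul_assoc]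
    have h := V_mem_tensorSpan ε hR hξ i s ht (hT _ (hξ i))
    dsimp only at h
    rw [← leftRep_V, V_ξ_tmul, ← hb] at h
    exact h
  · change tensorWord X (i :: s.1.1) at t
    change TensorRel R (i :: s.1.1) t b at ht
    cases ht with
    | cons _ _ y a t b hy ht =>
      have h := V_mem_tensorSpan ε hR hξ i s ht (hT _ hy)
      rw [← leftRep_V, V_circ_tmul, ← hθ _ _ ((hR i _ hy).symm.trans y.2)] at h
      exact h

include hR hξ in
theorem rightRep_mem_tensorSpan (i : K) (T : Module.End ℂ (X i).carrier) (θ : Module.End ℂ A)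
    (hT : ∀ p ∈ R i, (T p.1, θ p.2) ∈ R i) (hθ : ∀ a b, ε b = 0 → θ (a * b) = a * θ b)
    (hθ' : ∀ k ≠ i, ∀ p ∈ R k, θ p.2 = p.2 * θ 1) {p : FreeSpace X × A} (hp : p ∈ tensorSpan R) :
    (rightRep X i T p.1, θ p.2) ∈ tensorSpan R := by
  refine map_mem_tensorSpan _ θ (fun s t b ht => ?_) hp
  obtain ⟨s | s, rfl⟩ := (bijective_snocWord i).2 s
  · change tensorWord X s.1.1 at t
    change TensorRel R s.1.1 t b at ht
    have hb : θ b = b * θ 1 := by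
      obtain ⟨⟨s, hs⟩, hs'⟩ := s
      dsimp only at ht t hs'
      obtain rfl | ⟨r, k, rfl⟩ := List.eq_nil_or_concat' s
      · cases ht
        rw [one_mul]
      · have hk : k ≠ i := fun h => hs' (by rw [h]; simp)
        obtain ⟨t', b', y, a, hy, -, -, rfl⟩ := ht.exists_snoc
        rw [hθ _ _ ((hR k _ hy).symm.trans y.2), hθ' k hk _ hy, mul_assoc]
    have h := W_mem_tensorSpan ε hR hξ i s ht (hT _ (hξ i))
    dsimp only at h
    rw [← rightRep_W, W_ξ_tmul, ← hb] at h
    exact h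
  · change tensorWord X (s.1.1 ++ [i]) at t
    change TensorRel R (s.1.1 ++ [i]) t b at ht
    obtain ⟨t', b', y, a, hy, ht', rfl, rfl⟩ := ht.exists_snoc
    have h := W_mem_tensorSpan ε hR hξ i s ht' (hT _ hy)
    rw [← rightRep_W, W_circ_tmul, ← hθ _ _ ((hR i _ hy).symm.trans y.2)] at h
    exact h

end Correspondence

/-! ### Bi-free families have the joint distribution of the block model. -/

section JointDistribution

open Fock

variable {I : Type u} {J : Type v} {K : Type x}

/-- The two faces of a pair of homomorphisms into `ℒ(𝒳)`. -/
noncomputable def faces {Y : StateSpace.{max u v}}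
    (l : FreeAlgebra ℂ I →ₐ[ℂ] Module.End ℂ Y.carrier)
    (r : FreeAlgebra ℂ J →ₐ[ℂ] Module.End ℂ Y.carrier) : I ⊕ J → Module.End ℂ Y.carrier :=
  Sum.elim (fun i => l (FreeAlgebra.ι ℂ i)) (fun j => r (FreeAlgebra.ι ℂ j))

variable [DecidableEq K] {X : K → StateSpace.{max u v}}

/-- The pairs of vectors obtained from the state vector of `𝒳_k` and from the vacuum by applying
the same word. -/
noncomputable def wordSpan (T : ∀ k, I ⊕ J → Module.End ℂ (X k).carrier)
    (κ : K → List (I ⊕ J) → ℂ) (k : K) : Submodule ℂ ((X k).carrier × Fock ℂ K (I ⊕ J)) :=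
  Submodule.span ℂ (Set.range fun s : List (I ⊕ J) => ((s.map (T k)).prod (X k).ξ, vec κ k s))

variable {T : ∀ k, I ⊕ J → Module.End ℂ (X k).carrier} {κ : K → List (I ⊕ J) → ℂ}

theorem op_mem_wordSpan (k : K) (γ : I ⊕ J) {p : (X k).carrier × Fock ℂ K (I ⊕ J)}
    (hp : p ∈ wordSpan T κ k) : (T k γ p.1, op κ k γ p.2) ∈ wordSpan T κ k := by
  induction hp using Submodule.span_induction with
  | mem p hp =>
    obtain ⟨s, rfl⟩ := hp
    exact Submodule.subset_span ⟨γ :: s, rfl⟩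
  | zero =>
    rw [Prod.fst_zero, Prod.snd_zero, map_zero, map_zero]
    exact zero_mem _
  | add p q _ _ hp hq => simpa using add_mem hp hq
  | smul c p _ hp => simpa using Submodule.smul_mem _ c hp

theorem snd_mem_colour_of_mem_wordSpan (k : K) {p : (X k).carrier × Fock ℂ K (I ⊕ J)}
    (hp : p ∈ wordSpan T κ k) : p.2 ∈ colour ℂ (I ⊕ J) k := by
  induction hp using Submodule.span_induction with
  | mem p hp =>
    obtain ⟨s, rfl⟩ := hp
    exact vec_mem_colour κ k s
  | zero => exact zero_mem _
  | add p q _ _ hp hq => exact add_mem hp hq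
  | smul c p _ hp => exact Subalgebra.smul_mem _ hp c

theorem ψ_eq_of_mem_wordSpan
    (h : ∀ k s, (X k).ψ ((s.map (T k)).prod (X k).ξ) = vac (vec κ k s)) (k : K)
    (p : (X k).carrier × Fock ℂ K (I ⊕ J)) (hp : p ∈ wordSpan T κ k) :
    (X k).ψ p.1 = vac p.2 := by
  induction hp using Submodule.span_induction with
  | mem p hp =>
    obtain ⟨s, rfl⟩ := hp
    exact h k s
  | zero => simp
  | add p q _ _ hp hq => simp only [Prod.fst_add, Prod.snd_add, map_add, hp, hq]
  | smul c p _ hp => simp only [Prod.smul_fst, Prod.smul_snd, map_smul, hp]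

/-- A family of operators on a free product has the joint distribution of the operators on the
space of coloured blocks, if this holds for each colour. -/
theorem jointDistribution_modelFamily
    (l : ∀ k, FreeAlgebra ℂ I →ₐ[ℂ] Module.End ℂ (X k).carrier)
    (r : ∀ k, FreeAlgebra ℂ J →ₐ[ℂ] Module.End ℂ (X k).carrier) (κ : K → List (I ⊕ J) → ℂ)
    (h : ∀ k s, (X k).ψ ((s.map (faces (l k) (r k))).prod (X k).ξ) = vac (vec κ k s))
    (P : FreeAlgebra ℂ (K × (I ⊕ J))) :
    jointDistribution (freeProduct X).expect (modelFamily X l r) P =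
      vac (FreeAlgebra.lift ℂ (fun q : K × (I ⊕ J) => op κ q.1 q.2) P 1) := by
  set R := wordSpan (fun k => faces (l k) (r k)) κ with hRdef
  have hR := ψ_eq_of_mem_wordSpan h
  have hξ : ∀ k, ((X k).ξ, (1 : Fock ℂ K (I ⊕ J))) ∈ R k := fun k =>
    Submodule.subset_span ⟨[], rfl⟩
  -- The two conditions on `θ` come from the twisted derivation rule and from the vanishing of joins
  -- on the other colours.
  have hop : ∀ (k : K) (γ : I ⊕ J) (p : FreeSpace X × Fock ℂ K (I ⊕ J)), p ∈ tensorSpan R →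
      (modelFamily X l r k γ p.1, op κ k γ p.2) ∈ tensorSpan R := by
    rintro k (i | j) p hp
    · refine leftRep_mem_tensorSpan vac hR hξ k _ _ (fun p hp => op_mem_wordSpan k (Sum.inl i) hp)
        (fun a b ha => ?_) (fun c hc p hp => ?_) hp
      · rw [op, opL_mul, ha, zero_smul, add_zero]
      · have := (join_eq_zero (κ := κ) hc (Sum.inl i) (snd_mem_colour_of_mem_wordSpan c hp)).1
        rw [op, opL_apply, opL_apply, this, joinL_one, mul_one, add_zero, add_zero, add_mul,
          smul_mul_assoc, one_mul]
    · refine rightRep_mem_tensorSpan vac hR hξ k _ _ (fun p hp => op_mem_wordSpan k (Sum.inr j) hp)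
        (fun a b hb => ?_) (fun c hc p hp => ?_) hp
      · rw [op, opR_mul, hb, zero_smul, add_zero]
      · have := (join_eq_zero (κ := κ) hc (Sum.inr j) (snd_mem_colour_of_mem_wordSpan c hp)).2
        rw [op, opR_apply, opR_apply, this, joinR_one, one_mul, add_zero, add_zero, mul_add,
          mul_smul_comm, mul_one]
  have hP : ∀ p ∈ tensorSpan R,
      (FreeAlgebra.lift ℂ (fun q : K × (I ⊕ J) => modelFamily X l r q.1 q.2) P p.1,
        FreeAlgebra.lift ℂ (fun q : K × (I ⊕ J) => op κ q.1 q.2) P p.2) ∈ tensorSpan R := by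
    induction P using FreeAlgebra.induction with
    | grade0 c =>
      intro p hp
      simp only [AlgHom.commutes, Module.algebraMap_end_apply]
      exact Submodule.smul_mem _ c hp
    | grade1 q =>
      intro p hp
      simp only [FreeAlgebra.lift_ι_apply]
      exact hop q.1 q.2 p hp
    | mul a b ha hb =>
      intro p hp
      simp only [map_mul, Module.End.mul_apply]
      exact ha _ (hb _ hp)
    | add a b ha hb =>
      intro p hp
      simp only [map_add, LinearMap.add_apply]
      exact add_mem (ha _ hp) (hb _ hp)
  -- Start from the pair of vacuum vectors, apply the polynomial `P` to both sides, and compare the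
  -- states.
  exact ψ_eq_of_mem_tensorSpan vac hR
    (hP _ (mem_tensorSpan (s := ⟨[], List.isChain_nil⟩) TensorRel.nil))

/-- The joint distribution of a family of operators on a free product is that of the operators on
the space of coloured blocks. -/
theorem jointDistribution_modelFamily_cumulants
    (l : ∀ k, FreeAlgebra ℂ I →ₐ[ℂ] Module.End ℂ (X k).carrier)
    (r : ∀ k, FreeAlgebra ℂ J →ₐ[ℂ] Module.End ℂ (X k).carrier)
    (P : FreeAlgebra ℂ (K × (I ⊕ J))) :
    jointDistribution (freeProduct X).expect (modelFamily X l r) P =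
      vac (FreeAlgebra.lift ℂ (fun q : K × (I ⊕ J) => op (fun k => cumulants fun s =>
        (X k).ψ ((s.map (faces (l k) (r k))).prod (X k).ξ)) q.1 q.2) P 1) := by
  refine jointDistribution_modelFamily l r _ (fun k s => ?_) P
  rcases eq_or_ne s [] with rfl | hs
  · simp [vec, (X k).ψ_ξ]
  · rw [vac_vec, aeval_cumulants_momentPoly _ hs]

/-- The joint distribution of a bi-free family is that of the operators on the space of coloured
blocks, for suitable cumulants. -/
theorem IsBiFree.exists_cumulants {A : Type w} [Ring A] [Algebra ℂ A] {φ : A →ₗ[ℂ] ℂ}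
    {z : K → I ⊕ J → A} (h : IsBiFree φ z) :
    ∃ κ : K → List (I ⊕ J) → ℂ, ∀ P : FreeAlgebra ℂ (K × (I ⊕ J)),
      jointDistribution φ z P =
        vac (FreeAlgebra.lift ℂ (fun q : K × (I ⊕ J) => op κ q.1 q.2) P 1) := by
  obtain ⟨X, l, r, h⟩ := h
  exact ⟨_, fun P => h ▸ jointDistribution_modelFamily_cumulants l r P⟩

/-- The moments of a sum of families with the joint distribution of the operators on the space of
coloured blocks. -/
theorem moment_sum {A : Type w} [Ring A] [Algebra ℂ A] {φ : A →ₗ[ℂ] ℂ} {z : K → I ⊕ J → A}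
    {κ : K → List (I ⊕ J) → ℂ} (h : ∀ P : FreeAlgebra ℂ (K × (I ⊕ J)),
      jointDistribution φ z P =
        vac (FreeAlgebra.lift ℂ (fun q : K × (I ⊕ J) => op κ q.1 q.2) P 1))
    (S : Finset K) (s : List (I ⊕ J)) :
    φ ((s.map fun γ => ∑ k ∈ S, z k γ).prod) =
      MvPolynomial.aeval (∑ k ∈ S, κ k) (momentPoly s) := by
  rw [← vac_sum_op]
  have h' := h ((s.map fun γ => ∑ k ∈ S, FreeAlgebra.ι ℂ (k, γ)).prod)
  simp only [jointDistribution, LinearMap.comp_apply, AlgHom.toLinearMap_apply, map_list_prod,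
    List.map_map, Function.comp_def, map_sum, FreeAlgebra.lift_ι_apply] at h'
  exact h'

end JointDistribution

/-! ### Realization of arbitrary cumulants by bi-free pairs. -/

section Realization

open Fock MvPolynomial

variable {I : Type u} {J : Type v} {n : ℕ}

/-- The space spanned by the words, with a functional of given values on the words. -/
noncomputable def wordSpace {Γ : Type u} (m : List Γ → ℂ) (hm : m [] = 1) : StateSpace.{u} where
  carrier := List Γ →₀ ℂ
  ξ := Finsupp.single [] 1
  ψ := Finsupp.linearCombination ℂ m
  ψ_ξ := by simp [hm]

open Classical in
/-- The operator which prefixes a letter, for the letters in the range of `α`. -/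
noncomputable def prefixOp {Γ : Type u} (α : Fin n → Γ) (γ : Γ) : Module.End ℂ (List Γ →₀ ℂ) :=
  if γ ∈ Set.range α then Finsupp.lmapDomain ℂ ℂ (List.cons γ) else 0

theorem prod_prefixOp {Γ : Type u} (α : Fin n → Γ) (s : List Γ) (hs : ∀ γ ∈ s, γ ∈ Set.range α) :
    (s.map (prefixOp α)).prod (Finsupp.single [] 1) = Finsupp.single s 1 := by
  induction s with
  | nil => rfl
  | cons γ s ih =>
    rw [List.map_cons, List.prod_cons, Module.End.mul_apply,
      ih fun c hc => hs c (List.mem_cons_of_mem _ hc), prefixOp, if_pos (hs γ (by simp)),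
      Finsupp.lmapDomain_apply, Finsupp.mapDomain_single]

/-- Every choice of cumulants is realized by a bi-free pair in a probability space of any given
universe. -/
theorem exists_isBiFree (α : Fin n → I ⊕ J) (κ : Fin 2 → List (I ⊕ J) → ℂ) :
    ∃ (A : Type w) (_ : Ring A) (_ : Algebra ℂ A) (φ : A →ₗ[ℂ] ℂ) (z : Fin 2 → I ⊕ J → A),
      φ 1 = 1 ∧ IsBiFree φ z ∧ ∀ (S : Finset (Fin 2)) (s : List (I ⊕ J)), s ≠ [] →
        (∀ γ ∈ s, γ ∈ Set.range α) →
        φ ((s.map fun γ => ∑ k ∈ S, z k γ).prod) = aeval (∑ k ∈ S, κ k) (momentPoly s) := by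
  classical
  have hm : ∀ k, aeval (κ k) (momentPoly ([] : List (I ⊕ J))) = 1 := fun k => by
    simp [momentPoly, vec]
  let X : Fin 2 → StateSpace.{max u v} := fun k =>
    wordSpace (fun s => aeval (κ k) (momentPoly s)) (hm k)
  let l : ∀ k, FreeAlgebra ℂ I →ₐ[ℂ] Module.End ℂ (X k).carrier := fun k =>
    FreeAlgebra.lift ℂ fun i => (prefixOp α (Sum.inl i) : Module.End ℂ (List (I ⊕ J) →₀ ℂ))
  let r : ∀ k, FreeAlgebra ℂ J →ₐ[ℂ] Module.End ℂ (X k).carrier := fun k =>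
    FreeAlgebra.lift ℂ fun j => (prefixOp α (Sum.inr j) : Module.End ℂ (List (I ⊕ J) →₀ ℂ))
  have hlr : ∀ k, faces (l k) (r k) = prefixOp α := fun k => by
    funext γ
    cases γ <;> exact FreeAlgebra.lift_ι_apply _ _
  have hzero : ∀ k γ, γ ∉ Set.range α → modelFamily X l r k γ = 0 := fun k γ hγ => by
    have h := congrFun (hlr k) γ
    rw [prefixOp, if_neg hγ] at h
    cases γ with
    | inl i =>
      change leftRep X k (faces (l k) (r k) (Sum.inl i)) = 0
      rw [h]; exact map_zero _
    | inr j =>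
      change rightRep X k (faces (l k) (r k) (Sum.inr j)) = 0
      rw [h]; exact map_zero _
  -- Only the letters in the range of `α` act nontrivially, so `2n` generators suffice. This free
  -- algebra lives in the lowest universe and can be lifted to any `w`.
  let g : FreeAlgebra ℂ (Fin 2 × Fin n) →ₐ[ℂ] Module.End ℂ (freeProduct X).carrier :=
    FreeAlgebra.lift ℂ fun q => modelFamily X l r q.1 (α q.2)
  let G : ULift.{w} (FreeAlgebra ℂ (Fin 2 × Fin n)) →ₐ[ℂ] Module.End ℂ (freeProduct X).carrier :=
    g.comp ULift.algEquiv.toAlgHom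
  let φ : ULift.{w} (FreeAlgebra ℂ (Fin 2 × Fin n)) →ₗ[ℂ] ℂ :=
    (freeProduct X).expect ∘ₗ G.toLinearMap
  -- `α` need not be injective; any preimage of `γ` will do, since `g` sees only its image under
  -- `α`.
  let z : Fin 2 → I ⊕ J → ULift.{w} (FreeAlgebra ℂ (Fin 2 × Fin n)) := fun k γ =>
    if h : ∃ a, α a = γ then ULift.up (FreeAlgebra.ι ℂ (k, h.choose)) else 0
  have hz : ∀ k γ, G (z k γ) = modelFamily X l r k γ := fun k γ => by
    by_cases h : ∃ a, α a = γ
    · have h1 : G (z k γ) = g (FreeAlgebra.ι ℂ (k, h.choose)) := by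
        simp only [z, dif_pos h]; rfl
      rw [h1, FreeAlgebra.lift_ι_apply, h.choose_spec]
    · rw [hzero k γ h]
      simp only [z, dif_neg h, map_zero]
  have hjoint : jointDistribution φ z =
      jointDistribution (freeProduct X).expect (modelFamily X l r) := by
    have hcomp : G.comp (FreeAlgebra.lift ℂ fun q : Fin 2 × (I ⊕ J) => z q.1 q.2) =
        FreeAlgebra.lift ℂ fun q : Fin 2 × (I ⊕ J) => modelFamily X l r q.1 q.2 := by
      ext1
      funext q
      simp only [Function.comp_apply, AlgHom.comp_apply, FreeAlgebra.lift_ι_apply, hz]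
    ext1 P
    exact congrArg (freeProduct X).expect (DFunLike.congr_fun hcomp P)
  refine ⟨_, inferInstance, inferInstance, φ, z, ?_, ⟨X, l, r, hjoint⟩, fun S s hs hsα => ?_⟩
  · change (freeProduct X).expect (G 1) = 1
    rw [map_one]
    exact (freeProduct X).ψ_ξ
  · rw [moment_sum (fun P => hjoint ▸ jointDistribution_modelFamily_cumulants l r P) S s]
    -- Only subwords of `s` matter. Their letters lie in the range of `α`, so on them the operators
    -- have the prescribed moments and hence the cumulants `κ k`.
    refine aeval_momentPoly_congr hs fun t ht hts => ?_
    rw [Finset.sum_apply, Finset.sum_apply]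
    refine Finset.sum_congr rfl fun k _ => cumulants_eq ht fun c hc hct => ?_
    rw [hlr]
    refine Eq.symm ((congrArg (X k).ψ (prod_prefixOp α c fun γ hγ =>
      hsα γ ((hct.trans hts).subset hγ))).trans ?_)
    change Finsupp.linearCombination ℂ (fun s => aeval (κ k) (momentPoly s)) _ = _
    simp

end Realization

/-! ### Polynomials that double with their variables. -/

section Additive

open MvPolynomial

theorem coeff_aeval_two_mul_X {σ : Type*} (P : MvPolynomial σ ℂ) (d : σ →₀ ℕ) :
    coeff d (aeval (fun i => C 2 * X i : σ → MvPolynomial σ ℂ) P) =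
      2 ^ d.degree * coeff d P := by
  classical
  induction P using MvPolynomial.induction_on' with
  | monomial e a =>
    have h : aeval (fun i => C 2 * X i : σ → MvPolynomial σ ℂ) (monomial e a) =
        monomial e (2 ^ e.degree * a) := by
      rw [aeval_monomial, monomial_eq, Finsupp.prod, Finsupp.prod]
      simp only [mul_pow, Finset.prod_mul_distrib, Finset.prod_pow_eq_pow_sum, algebraMap_eq,
        map_mul, map_pow]
      rw [Finsupp.degree_apply]
      ring
    rw [h, coeff_monomial, coeff_monomial]
    split_ifs with hed
    · rw [hed]
    · rw [mul_zero]
  | add p q hp hq => rw [map_add, coeff_add, hp, hq, coeff_add, mul_add]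

/-- A polynomial which doubles when its variables are doubled is linear; so it vanishes when it is
weighted homogeneous and its variables have smaller weights. -/
theorem eq_zero_of_doubling {σ : Type*} {a : σ → ℕ} {n : ℕ} {P : MvPolynomial σ ℂ}
    (hP : IsWeightedHomogeneous a P n) (hP' : P ∈ supported ℂ {i | a i < n})
    (h : ∀ κ : σ → ℂ, aeval κ P + aeval κ P = aeval (κ + κ) P) : P = 0 := by
  have h2 : aeval (fun i => C 2 * X i : σ → MvPolynomial σ ℂ) P = P + P := by
    refine MvPolynomial.funext fun κ => ?_
    rw [map_add]
    have hκ : (fun i => aeval κ (C 2 * X i : MvPolynomial σ ℂ)) = κ + κ := by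
      funext i
      simp [two_mul]
    have hc := comp_aeval_apply (fun i => C 2 * X i : σ → MvPolynomial σ ℂ) (aeval κ) P
    rw [hκ, ← h κ] at hc
    exact hc
  ext d
  rw [coeff_zero]
  by_contra hd
  have hc := congrArg (coeff d) h2
  rw [coeff_aeval_two_mul_X, coeff_add, ← two_mul] at hc
  -- Comparing coefficients forces total degree one for every monomial that occurs, so the monomial
  -- is a single variable and its weight must be `n`.
  have hc' : (2 : ℂ) ^ d.degree = 2 ^ 1 := by simpa using mul_right_cancel₀ hd hc
  have hdeg : d.degree = 1 := Nat.pow_right_injective le_rfl (by exact_mod_cast hc')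
  obtain ⟨i, rfl⟩ : ∃ i, d = Finsupp.single i 1 := by
    rw [← Finsupp.sum_eq_one_iff, Finsupp.sum, ← Finsupp.degree_apply, hdeg]
  have hw := hP hd
  rw [Finsupp.weight_single, one_smul] at hw
  have hi : i ∈ P.vars := (mem_vars_iff_mem_support i).2 ⟨_, mem_support_iff.2 hd, by simp⟩
  exact absurd hw (ne_of_lt (mem_supported.1 hP' hi))

end Additive

/-! ### Subwords of `α` as sublists. -/

section Subwords

variable {Γ : Type x} {n : ℕ} (α : Fin n → Γ)

theorem length_subword (K : Finset (Fin n)) : (subword α K).length = K.card := by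
  simp [subword]

theorem subword_ne_nil {K : Finset (Fin n)} (hK : K.Nonempty) : subword α K ≠ [] := by
  rw [← List.length_pos_iff, length_subword]
  exact hK.card_pos

theorem mem_range_of_mem_subword {K : Finset (Fin n)} {γ : Γ} (h : γ ∈ subword α K) :
    γ ∈ Set.range α := by
  obtain ⟨a, -, rfl⟩ := List.mem_map.1 h
  exact ⟨a, rfl⟩

/-- A sublist of the image lifts to a sublist of the sorted positions; being sorted and
duplicate-free, this is the sorted list of its own set of entries. -/
theorem exists_subword_eq {t : List Γ} (h : t.Sublist (subword α Finset.univ)) :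
    ∃ K : Finset (Fin n), subword α K = t := by
  obtain ⟨s, hs, rfl⟩ := List.sublist_map_iff.1 h
  refine ⟨s.toFinset, congrArg (List.map α) ?_⟩
  have hsort : s.Pairwise (· ≤ ·) := (Finset.pairwise_sort Finset.univ (· ≤ ·)).sublist hs
  exact (List.toFinset_sort (· ≤ ·) ((Finset.sort_nodup Finset.univ (· ≤ ·)).sublist hs)).2 hsort

end Subwords

/-! ### Existence and uniqueness. -/

section MainTheorem

open MvPolynomial

variable {I : Type u} {J : Type v} {n : ℕ} (α : Fin n → I ⊕ J)

theorem sum_univ_pair {A : Type w} [Ring A] (z' z'' : I ⊕ J → A) (γ : I ⊕ J) :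
    ∑ k ∈ (Finset.univ : Finset (Fin 2)), ![z', z''] k γ = (z' + z'') γ := by
  simp [Fin.sum_univ_two]

/-- The indices of the moments of the proper subwords of `α`. -/
def properIndices : Set (MomentIndex α) :=
  {s | ∃ (K : Finset (Fin n)) (hK : K.Nonempty), K ⊂ Finset.univ ∧ s = momentIndex α K hK}

theorem length_lt_of_mem_properIndices {s : MomentIndex α} (hs : s ∈ properIndices α) :
    s.1.length < n := by
  obtain ⟨K, hK, hlt, rfl⟩ := hs
  have h := Finset.card_lt_card hlt
  rw [Finset.card_univ, Fintype.card_fin] at h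
  rwa [momentIndex, length_subword]

theorem ne_nil_of_momentIndex (s : MomentIndex α) : s.1 ≠ [] := by
  obtain ⟨_, K, hK, rfl⟩ := s
  exact subword_ne_nil α hK

open Classical in
/-- The variable attached to a word, if it is of the form `α K`. -/
noncomputable def indexVar (s : List (I ⊕ J)) : MvPolynomial (MomentIndex α) ℂ :=
  if h : ∃ K : Finset (Fin n), K.Nonempty ∧ subword α K = s then X ⟨s, h⟩ else 0

theorem indexVar_of_mem (s : MomentIndex α) : indexVar α s.1 = X s := dif_pos s.2

theorem isWeightedHomogeneous_indexVar (s : List (I ⊕ J)) :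
    IsWeightedHomogeneous (fun s : MomentIndex α => s.1.length) (indexVar α s) s.length := by
  unfold indexVar
  split_ifs with h
  · exact isWeightedHomogeneous_X ℂ (fun s : MomentIndex α => s.1.length) ⟨s, h⟩
  · exact isWeightedHomogeneous_zero _ _ _

theorem exists_index_of_sublist {t : List (I ⊕ J)} (ht : t ≠ [])
    (hts : t.Sublist (subword α Finset.univ)) : ∃ s : MomentIndex α, s.1 = t := by
  obtain ⟨K, rfl⟩ := exists_subword_eq α hts
  refine ⟨⟨_, K, ?_, rfl⟩, rfl⟩
  rw [Finset.nonempty_iff_ne_empty]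
  rintro rfl
  exact ht (by simp [subword])

theorem mem_properIndices {s : MomentIndex α} (hs : s.1.length < n) : s ∈ properIndices α := by
  obtain ⟨_, K, hK, rfl⟩ := s
  refine ⟨K, hK, Finset.ssubset_univ_iff.2 ?_, rfl⟩
  rintro rfl
  rw [length_subword, Finset.card_univ, Fintype.card_fin] at hs
  exact lt_irrefl _ hs

/-- The cumulant of `α` as a polynomial in the moments `X_{αK}`. -/
noncomputable def cumulant : MvPolynomial (MomentIndex α) ℂ :=
  aeval (indexVar α) (cumulantPoly (subword α Finset.univ))

theorem isWeightedHomogeneous_cumulant (hn : subword α Finset.univ ≠ []) :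
    IsWeightedHomogeneous (fun s : MomentIndex α => s.1.length) (cumulant α) n := by
  have h := isWeightedHomogeneous_aeval (isWeightedHomogeneous_indexVar α)
    (isWeightedHomogeneous_cumulantPoly _ hn)
  rwa [length_subword, Finset.card_univ, Fintype.card_fin] at h

theorem cumulant_sub_mem_supported (hn : (Finset.univ : Finset (Fin n)).Nonempty) :
    cumulant α - X (momentIndex α Finset.univ hn) ∈ supported ℂ (properIndices α) := by
  have h : cumulant α - X (momentIndex α Finset.univ hn) = aeval (indexVar α)
      (cumulantPoly (subword α Finset.univ) - X (subword α Finset.univ)) := by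
    rw [map_sub, aeval_X, ← indexVar_of_mem]; rfl
  rw [h]
  refine aeval_mem_supported (fun t ht => ?_)
    (cumulantPoly_sub_mem_supported _ (subword_ne_nil α hn))
  obtain ⟨s, rfl⟩ := exists_index_of_sublist α ht.1 ht.2.1
  rw [indexVar_of_mem]
  refine X_mem_supported.2 (mem_properIndices α (ht.2.2.trans_eq ?_))
  rw [length_subword, Finset.card_univ, Fintype.card_fin]

/-- `cumulantPoly` involves only nonempty sublists of the full word. Each of them is an `α K`, so
the default `0` of `indexVar` never enters. -/
theorem eval_cumulant (hn : (Finset.univ : Finset (Fin n)).Nonempty) {A : Type w} [Ring A]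
    [Algebra ℂ A] (φ : A →ₗ[ℂ] ℂ) (z : I ⊕ J → A) :
    eval (moments φ z α) (cumulant α) =
      cumulants (fun s => φ (s.map z).prod) (subword α Finset.univ) := by
  have hs := subword_ne_nil α hn
  have key : ∀ t ≠ [], t.Sublist (subword α Finset.univ) →
      aeval (moments φ z α) (indexVar α t) = φ (t.map z).prod := fun t ht hts => by
    obtain ⟨s, rfl⟩ := exists_index_of_sublist α ht hts
    rw [indexVar_of_mem, aeval_X, moments]
  rw [← coe_aeval_eq_eval, cumulant, cumulants,
    ← sub_add_cancel (cumulantPoly (subword α Finset.univ)) (X (subword α Finset.univ))]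
  change aeval _ _ = _
  rw [comp_aeval_apply, map_add, map_add, aeval_X, aeval_X, key _ hs (List.Sublist.refl _)]
  exact congrArg (· + _) (aeval_congr_of_mem_supported (fun t ht => key t ht.1 ht.2.1)
    (cumulantPoly_sub_mem_supported _ hs))

/-- The cumulant property of `cumulant α`. -/
theorem eval_cumulant_add (hn : (Finset.univ : Finset (Fin n)).Nonempty) {A : Type w} [Ring A]
    [Algebra ℂ A] (φ : A →ₗ[ℂ] ℂ) (z' z'' : I ⊕ J → A) (h : IsBiFree φ ![z', z'']) :
    eval (moments φ z' α) (cumulant α) + eval (moments φ z'' α) (cumulant α) =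
      eval (moments φ (z' + z'') α) (cumulant α) := by
  obtain ⟨κ, hκ⟩ := h.exists_cumulants
  have hs := subword_ne_nil α hn
  have h1 : ∀ s, φ (s.map z').prod = aeval (κ 0) (momentPoly s) := fun s => by
    have h := moment_sum hκ {0} s
    simp only [Finset.sum_singleton] at h
    exact h
  have h2 : ∀ s, φ (s.map z'').prod = aeval (κ 1) (momentPoly s) := fun s => by
    have h := moment_sum hκ {1} s
    simp only [Finset.sum_singleton] at h
    exact h
  have h3 : ∀ s, φ (s.map (z' + z'')).prod = aeval (∑ k, κ k) (momentPoly s) := fun s => by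
    have h := moment_sum hκ Finset.univ s
    simp only [sum_univ_pair] at h
    exact h
  rw [eval_cumulant α hn, eval_cumulant α hn, eval_cumulant α hn,
    cumulants_eq hs fun t _ _ => (h1 t).symm, cumulants_eq hs fun t _ _ => (h2 t).symm,
    cumulants_eq hs fun t _ _ => (h3 t).symm, Fin.sum_univ_two, Pi.add_apply]

/-- There is no nonzero additive polynomial in the moments of proper subwords. -/
theorem eq_zero_of_additive {D : MvPolynomial (MomentIndex α) ℂ}
    (hD : D ∈ supported ℂ (properIndices α))
    (hD' : IsWeightedHomogeneous (fun s : MomentIndex α => s.1.length) D n)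
    (hadd : ∀ (A : Type w) [Ring A] [Algebra ℂ A] (φ : A →ₗ[ℂ] ℂ), φ 1 = 1 →
      ∀ z' z'' : I ⊕ J → A, IsBiFree φ ![z', z''] →
        eval (moments φ z' α) D + eval (moments φ z'' α) D = eval (moments φ (z' + z'') α) D) :
    D = 0 := by
  classical
  set P : MvPolynomial (List (I ⊕ J)) ℂ := aeval (fun s : MomentIndex α => momentPoly s.1) D
    with hPdef
  have hP : ∀ κ : List (I ⊕ J) → ℂ,
      aeval κ P = aeval (fun s : MomentIndex α => aeval κ (momentPoly s.1)) D := fun κ =>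
    comp_aeval_apply _ _ _
  have hP0 : P = 0 := by
    refine eq_zero_of_doubling (isWeightedHomogeneous_aeval
      (fun s => isWeightedHomogeneous_momentPoly (ne_nil_of_momentIndex α s)) hD')
      (aeval_mem_supported (fun s hs => ?_) hD) fun κ => ?_
    · have hlt := length_lt_of_mem_properIndices α hs
      rw [momentPoly_eq]
      exact add_mem (X_mem_supported.2 hlt) (supported_mono (fun t ht => ht.2.2.trans hlt)
        (momentRest_spec (ne_nil_of_momentIndex α s)).2)
    -- Both members of the pair receive the same cumulants `κ`, so their sum has cumulants `κ + κ`
    -- and additivity becomes doubling.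
    · obtain ⟨A, _, _, φ, z, hφ, hz, hmom⟩ := exists_isBiFree.{u, v, w} α fun _ => κ
      have hz' : ![z 0, z 1] = z := by
        funext k
        fin_cases k <;> rfl
      have h := hadd A φ hφ (z 0) (z 1) (by rwa [hz'])
      have hS : ∀ (S : Finset (Fin 2)) (y : I ⊕ J → A), (∀ γ, ∑ k ∈ S, z k γ = y γ) →
          eval (moments φ y α) D = aeval (∑ k ∈ S, κ) P := fun S y hy => by
        rw [hP, ← coe_aeval_eq_eval]
        refine congrArg (fun f => aeval f D) (funext fun s => ?_)
        rw [← hmom S s.1 (ne_nil_of_momentIndex α s), moments]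
        · simp only [hy]
        · obtain ⟨_, K, hK, rfl⟩ := s
          exact fun γ hγ => mem_range_of_mem_subword α hγ
      rw [hS {0} (z 0) (by simp), hS {1} (z 1) (by simp),
        hS Finset.univ (z 0 + z 1) (by simp [Fin.sum_univ_two])] at h
      simpa only [Fin.sum_univ_two, Finset.sum_singleton] using h
  -- Passing to cumulants loses nothing: for arbitrary values `m` of the moment variables,
  -- evaluating `P` at the associated cumulants gives back `D` at `m`.
  refine MvPolynomial.funext fun m => ?_
  have h := hP (cumulants fun s => aeval m (indexVar α s))
  rw [hP0, map_zero] at h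
  rw [map_zero, h, ← coe_aeval_eq_eval]
  refine congrArg (fun f => aeval f D) (funext fun s => ?_)
  rw [aeval_cumulants_momentPoly _ (ne_nil_of_momentIndex α s), indexVar_of_mem, aeval_X]

end MainTheorem

end BiFree

theorem theorem5p7 {I : Type u} {J : Type v} {n : ℕ} (hn : 0 < n) (α : Fin n → I ⊕ J) :
    ∃! R : MvPolynomial (BiFree.MomentIndex α) ℂ,
      (∃ Rt ∈ MvPolynomial.supported ℂ
          {s : BiFree.MomentIndex α | ∃ (K : Finset (Fin n)) (hK : K.Nonempty),
            K ⊂ Finset.univ ∧ s = BiFree.momentIndex α K hK},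
        R = MvPolynomial.X (BiFree.momentIndex α Finset.univ ⟨⟨0, hn⟩, Finset.mem_univ _⟩) + Rt) ∧
      MvPolynomial.IsWeightedHomogeneous
        (fun s : BiFree.MomentIndex α => s.1.length) R n ∧
      ∀ (A : Type w) [Ring A] [Algebra ℂ A] (φ : A →ₗ[ℂ] ℂ), φ 1 = 1 →
        ∀ z' z'' : I ⊕ J → A, BiFree.IsBiFree φ ![z', z''] →
          MvPolynomial.eval (BiFree.moments φ z' α) R +
              MvPolynomial.eval (BiFree.moments φ z'' α) R =
            MvPolynomial.eval (BiFree.moments φ (z' + z'') α) R := by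
  have hne : (Finset.univ : Finset (Fin n)).Nonempty := ⟨⟨0, hn⟩, Finset.mem_univ _⟩
  have hsupp := BiFree.cumulant_sub_mem_supported α hne
  have hhom := BiFree.isWeightedHomogeneous_cumulant α (BiFree.subword_ne_nil α hne)
  refine ⟨BiFree.cumulant α, ⟨⟨_, hsupp, (add_sub_cancel _ _).symm⟩, hhom,
    fun A _ _ φ _ z' z'' h => BiFree.eval_cumulant_add α hne φ z' z'' h⟩, ?_⟩
  rintro R ⟨⟨Rt, hRt, rfl⟩, hR, hadd⟩
  rw [← sub_eq_zero]
  refine BiFree.eq_zero_of_additive.{u, v, w} α ?_ (hR.sub hhom) fun A _ _ φ hφ z' z'' h => ?_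
  · rw [add_sub_right_comm, ← neg_sub, add_comm, ← sub_eq_add_neg]
    exact sub_mem hRt hsupp
  · rw [map_sub, map_sub, map_sub, ← hadd A φ hφ z' z'' h,
      ← BiFree.eval_cumulant_add α hne φ z' z'' h]
    abel
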